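/- Let $d\in(0,\infty)$ and $\Omega=\{(x,y)\in\mathbb{R}^2:\ x\ge 0,\ y\ge 0,\ |x-y|\le d\}$. For real-valued $\sigma,\alpha\in L^\infty(\mathbb{R}_+)$, $\mathbb{R}_+=[0,\infty)$, let $-\Delta^d_{\sigma,\alpha}$ be the self-adjoint operator on $L^2(\Omega)$ (complex-valued functions) associated with the closed, semi-bounded quadratic form $$q^d_{\alpha,\sigma}[\varphi]=\int_\Omega|\nabla\varphi|^2\,\mathrm{d}x\,\mathrm{d}y-\int_0^d\sigma(y)\bigl(|\varphi(y,0)|^2+|\varphi(0,y)|^2\bigr)\,\mathrm{d}y+\int_0^\infty\alpha(y)\,|\varphi(y,y)|^2\,\mathrm{d}y$$ with domain $\{\varphi\in H^1(\Omega):\ \varphi=0 \text{ on } \{(x,y)\in\Omega:\ |x-y|=d\}\}$, where boundary values and values on the diagonal are taken in the sense of traces. The discrete spectrum $\sigma_d(A)$ of an operator $A$ is the set of its eigenvalues of finite multiplicity that are isolated points of its spectrum. Then there is a constant $\gamma<0$, depending only on $d$, such that for all real-valued $\sigma,\alpha\in L^\infty(\mathbb{R}_+)$ with $\sigma(y)\le\gamma$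 for a.e. $y\in[0,d]$, $\alpha(y)\ge 0$ for a.e. $y\in[0,\infty)$, and $\alpha(y)\to 0$ as $y\to\infty$ (up to null sets), one has $$\sigma_d(-\Delta^d_{\sigma,\alpha})=\emptyset .$$ -/

import Mathlib

open MeasureTheory Filter Topology
open scoped ENNReal ContDiff

noncomputable section

/-! ### Spectral notions for unbounded operators -/

namespace UnboundedOperator

variable {H : Type*} [NormedAddCommGroup H] [InnerProductSpace ℂ H]

/-- The resolvent set: those `z` for which `A - z` maps the domain of `A` bijectively onto the
whole space with bounded inverse `R`. -/
def resolventSet (A : H →ₗ.[ℂ] H) : Set ℂ :=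
  {z | ∃ R : H →L[ℂ] H,
    (∀ f : H, ∃ h : R f ∈ A.domain, A ⟨R f, h⟩ - z • R f = f) ∧
    (∀ φ : A.domain, R (A φ - z • (φ : H)) = φ)}

/-- The spectrum. -/
def spectrum (A : H →ₗ.[ℂ] H) : Set ℂ := (resolventSet A)ᶜ

/-- The eigenspace `ker (A - z)`, as a subspace of the domain of `A`. -/
def eigenspace (A : H →ₗ.[ℂ] H) (z : ℂ) : Submodule ℂ A.domain :=
  LinearMap.ker (A.toFun - z • A.domain.subtype)

/-- The discrete spectrum: the eigenvalues of finite multiplicity that are isolated points of the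
spectrum. -/
def discreteSpectrum (A : H →ₗ.[ℂ] H) : Set ℂ :=
  {z | eigenspace A z ≠ ⊥ ∧ FiniteDimensional ℂ (eigenspace A z) ∧
    ∃ ε > 0, ∀ w ∈ spectrum A, dist w z < ε → w = z}

end UnboundedOperator

namespace PencilModel

/-! ### The Sobolev space `H¹` and traces on curves in the plane -/

/-- The complex Hilbert space `L²(Ω)`. -/
abbrev L2 (Ω : Set (ℝ × ℝ)) : Type := Lp ℂ 2 (volume.restrict Ω)

/-- The complex Hilbert space `L²(I)` over a subset of the line. -/
abbrev L2line (I : Set ℝ) : Type := Lp ℂ 2 (volume.restrict I)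

/-- `v` is the weak partial derivative of `u` in the direction `e` on the interior of `Ω`. -/
def IsWeakDeriv (Ω : Set (ℝ × ℝ)) (e : ℝ × ℝ) (u v : L2 Ω) : Prop :=
  ∀ η : ℝ × ℝ → ℝ, ContDiff ℝ ∞ η → HasCompactSupport η → tsupport η ⊆ interior Ω →
    ∫ p in Ω, fderiv ℝ η p e • u p = - ∫ p in Ω, η p • v p

/-- Square integrable functions `u` listed with candidates for their partial derivatives, as
`(u, ∂ₓu, ∂ᵧu)`. -/
abbrev Jet (Ω : Set (ℝ × ℝ)) : Type := L2 Ω × L2 Ω × L2 Ω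

/-- `F` is a function of class `H¹(Ω)` listed with its weak partial derivatives
(which are unique): `F = (u, ∂ₓu, ∂ᵧu)`. -/
def IsH1 (Ω : Set (ℝ × ℝ)) (F : Jet Ω) : Prop :=
  IsWeakDeriv Ω (1, 0) F.1 F.2.1 ∧ IsWeakDeriv Ω (0, 1) F.1 F.2.2

/-- `g ∈ L²(I)` is the trace of `F = (u, ∂ₓu, ∂ᵧu) ∈ H¹(Ω)` along the curve `c : I → closure Ω`:
there are smooth functions `w n` on the plane which converge to `u` in `H¹(Ω)` and whose
restrictions `w n ∘ c` to the curve converge to `g` in `L²(I)`. -/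
def HasTrace (Ω : Set (ℝ × ℝ)) (c : ℝ → ℝ × ℝ) (I : Set ℝ) (F : Jet Ω) (g : L2line I) : Prop :=
  ∃ w : ℕ → ℝ × ℝ → ℂ, (∀ n, ContDiff ℝ ∞ (w n) ∧ HasCompactSupport (w n)) ∧
    Tendsto (fun n => eLpNorm (fun p => w n p - F.1 p) 2 (volume.restrict Ω)) atTop (𝓝 0) ∧
    Tendsto (fun n => eLpNorm (fun p => fderiv ℝ (w n) p (1, 0) - F.2.1 p) 2
      (volume.restrict Ω)) atTop (𝓝 0) ∧
    Tendsto (fun n => eLpNorm (fun p => fderiv ℝ (w n) p (0, 1) - F.2.2 p) 2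
      (volume.restrict Ω)) atTop (𝓝 0) ∧
    Tendsto (fun n => eLpNorm (fun t => w n (c t) - g t) 2 (volume.restrict I)) atTop (𝓝 0)

/-! ### The two-particle configuration space, the form and the operator -/

/-- The configuration space `{(x, y) : x, y ≥ 0, |x - y| ≤ d}`. -/
def pencil (d : ℝ) : Set (ℝ × ℝ) := {p | 0 ≤ p.1 ∧ 0 ≤ p.2 ∧ |p.1 - p.2| ≤ d}

/-- An `H¹` jet together with its traces on `{y = 0}`, `{x = 0}` and `{x = y}`. -/
abbrev FormData (d : ℝ) : Type :=
  Jet (pencil d) × L2line (Set.Icc 0 d) × L2line (Set.Icc 0 d) × L2line (Set.Ici 0)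

/-- The form domain `{φ ∈ H¹(Ω) : φ = 0 on |x - y| = d}`. Each `φ` is listed with its gradient and
its traces `φ(y, 0)`, `φ(0, y)` for `y ∈ [0, d]` and `φ(y, y)` for `y ≥ 0`, which it determines. -/
def InFormDomain (d : ℝ) (F : FormData d) : Prop :=
  IsH1 (pencil d) F.1 ∧
  HasTrace (pencil d) (fun t => (t + d, t)) (Set.Ici 0) F.1 0 ∧
  HasTrace (pencil d) (fun t => (t, t + d)) (Set.Ici 0) F.1 0 ∧
  HasTrace (pencil d) (fun t => (t, 0)) (Set.Icc 0 d) F.1 F.2.1 ∧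
  HasTrace (pencil d) (fun t => (0, t)) (Set.Icc 0 d) F.1 F.2.2.1 ∧
  HasTrace (pencil d) (fun t => (t, t)) (Set.Ici 0) F.1 F.2.2.2

/-- The space `L^∞(ℝ₊)` of real potentials. -/
abbrev Potential : Type := Lp ℝ ∞ (volume.restrict (Set.Ici (0 : ℝ)))

/-- The sesquilinear form (antilinear in `G`) that belongs to the quadratic form
`∫_Ω |∇φ|² - ∫_0^d σ(y) (|φ(y,0)|² + |φ(0,y)|²) dy + ∫_0^∞ α(y) |φ(y,y)|² dy`. -/
def form (d : ℝ) (σ α : Potential) (G F : FormData d) : ℂ :=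
  (∫ p in pencil d, (inner ℂ (G.1.2.1 p) (F.1.2.1 p) + inner ℂ (G.1.2.2 p) (F.1.2.2 p)))
    - (∫ y in Set.Icc 0 d,
        (σ y : ℂ) * (inner ℂ (G.2.1 y) (F.2.1 y) + inner ℂ (G.2.2.1 y) (F.2.2.1 y)))
    + ∫ y in Set.Ici 0, (α y : ℂ) * inner ℂ (G.2.2.2 y) (F.2.2.2 y)

/-- `(φ, f)` lies in the graph of the operator of the form: `φ` is in the form domain and
`q(ψ, φ) = ⟨ψ, f⟩` for all `ψ` in the form domain. -/
def InOperatorGraph (d : ℝ) (σ α : Potential) (φ f : L2 (pencil d)) : Prop :=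
  ∃ F : FormData d, InFormDomain d F ∧ F.1.1 = φ ∧
    ∀ G : FormData d, InFormDomain d G → form d σ α G F = inner ℂ G.1.1 f

lemma IsWeakDeriv.add {Ω : Set (ℝ × ℝ)} {e : ℝ × ℝ} {u v u' v' : L2 Ω}
    (h : IsWeakDeriv Ω e u v) (h' : IsWeakDeriv Ω e u' v') :
    IsWeakDeriv Ω e (u + u') (v + v') := by
  intro η h1 h2 h3
  have key : ∀ (θ : ℝ × ℝ → ℝ) (a : L2 Ω), Continuous θ → HasCompactSupport θ →
      Integrable (fun p => θ p • a p) (volume.restrict Ω) := fun θ a hc hs =>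
    ((Lp.memLp a).locallyIntegrable (by norm_num)).integrable_smul_left_of_hasCompactSupport hc hs
  have hd : Continuous fun p => fderiv ℝ η p e := (h1.continuous_fderiv (by simp)).clm_apply
    continuous_const
  have hds : HasCompactSupport fun p => fderiv ℝ η p e :=
    (h2.fderiv (𝕜 := ℝ)).comp_left (g := fun L : ℝ × ℝ →L[ℝ] ℝ => L e) (by simp)
  have e1 : (∫ p in Ω, fderiv ℝ η p e • (u + u') p)
      = (∫ p in Ω, fderiv ℝ η p e • u p) + ∫ p in Ω, fderiv ℝ η p e • u' p := by
    rw [← integral_add (key _ u hd hds) (key _ u' hd hds)]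
    refine integral_congr_ae ?_
    filter_upwards [Lp.coeFn_add u u'] with p hp
    rw [hp, Pi.add_apply, smul_add]
  have e2 : (∫ p in Ω, η p • (v + v') p)
      = (∫ p in Ω, η p • v p) + ∫ p in Ω, η p • v' p := by
    rw [← integral_add (key _ v h1.continuous h2) (key _ v' h1.continuous h2)]
    refine integral_congr_ae ?_
    filter_upwards [Lp.coeFn_add v v'] with p hp
    rw [hp, Pi.add_apply, smul_add]
  rw [e1, e2, h η h1 h2 h3, h' η h1 h2 h3]
  ring

lemma IsWeakDeriv.smul {Ω : Set (ℝ × ℝ)} {e : ℝ × ℝ} {u v : L2 Ω} (k : ℂ)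
    (h : IsWeakDeriv Ω e u v) : IsWeakDeriv Ω e (k • u) (k • v) := by
  intro η h1 h2 h3
  have key : ∀ (θ : ℝ × ℝ → ℝ) (a : L2 Ω),
      (∫ p in Ω, θ p • (k • a) p) = k * ∫ p in Ω, θ p • a p := fun θ a => by
    rw [← integral_const_mul]
    refine integral_congr_ae ?_
    filter_upwards [Lp.coeFn_smul k a] with p hp
    rw [hp, Pi.smul_apply, smul_eq_mul, Complex.real_smul, Complex.real_smul]
    ring
  rw [key, key, h η h1 h2 h3]
  ring

lemma tendsto_eLpNorm_add {X : Type*} [MeasurableSpace X] {μ : Measure X}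
    {a b : ℕ → X → ℂ} {u v : Lp ℂ 2 μ}
    (ha : ∀ n, AEStronglyMeasurable (a n) μ) (hb : ∀ n, AEStronglyMeasurable (b n) μ)
    (h : Tendsto (fun n => eLpNorm (fun p => a n p - u p) 2 μ) atTop (𝓝 0))
    (h' : Tendsto (fun n => eLpNorm (fun p => b n p - v p) 2 μ) atTop (𝓝 0)) :
    Tendsto (fun n => eLpNorm (fun p => (a n p + b n p) - (u + v) p) 2 μ) atTop (𝓝 0) := by
  have hs := h.add h'
  rw [add_zero] at hs
  refine tendsto_of_tendsto_of_tendsto_of_le_of_le tendsto_const_nhds hs (fun _ => zero_le)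
    fun n => ?_
  have : eLpNorm (fun p => (a n p + b n p) - (u + v) p) 2 μ
      = eLpNorm ((fun p => a n p - u p) + fun p => b n p - v p) 2 μ := by
    refine eLpNorm_congr_ae ?_
    filter_upwards [Lp.coeFn_add u v] with p hp
    simp only [hp, Pi.add_apply]
    ring
  rw [this]
  exact eLpNorm_add_le ((ha n).sub (Lp.aestronglyMeasurable u))
    ((hb n).sub (Lp.aestronglyMeasurable v)) (by norm_num)

lemma tendsto_eLpNorm_smul {X : Type*} [MeasurableSpace X] {μ : Measure X}
    {a : ℕ → X → ℂ} {u : Lp ℂ 2 μ} (k : ℂ)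
    (h : Tendsto (fun n => eLpNorm (fun p => a n p - u p) 2 μ) atTop (𝓝 0)) :
    Tendsto (fun n => eLpNorm (fun p => k * a n p - (k • u) p) 2 μ) atTop (𝓝 0) := by
  have hs := ENNReal.Tendsto.const_mul (a := ‖k‖ₑ) h (Or.inr (by simp))
  rw [mul_zero] at hs
  refine hs.congr fun n => ?_
  rw [← eLpNorm_const_smul]
  refine eLpNorm_congr_ae ?_
  filter_upwards [Lp.coeFn_smul k u] with p hp
  simp only [hp, Pi.smul_apply, smul_eq_mul]
  ring

lemma HasTrace.add {Ω : Set (ℝ × ℝ)} {c : ℝ → ℝ × ℝ} {I : Set ℝ} (hc : Continuous c)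
    {F F' : Jet Ω} {g g' : L2line I} (h : HasTrace Ω c I F g) (h' : HasTrace Ω c I F' g') :
    HasTrace Ω c I (F + F') (g + g') := by
  obtain ⟨w, hw, h1, h2, h3, h4⟩ := h
  obtain ⟨w', hw', h1', h2', h3', h4'⟩ := h'
  have hcd : ∀ (f : ℝ × ℝ → ℂ) (e : ℝ × ℝ), ContDiff ℝ ∞ f →
      Continuous fun p => fderiv ℝ f p e := fun f e hf =>
    (hf.continuous_fderiv (by simp)).clm_apply continuous_const
  have hder : ∀ n p e, fderiv ℝ (fun p => w n p + w' n p) p e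
      = fderiv ℝ (w n) p e + fderiv ℝ (w' n) p e := fun n p e => by
    rw [fderiv_fun_add ((hw n).1.differentiable (by simp) p)
      ((hw' n).1.differentiable (by simp) p)]
    rfl
  refine ⟨fun n p => w n p + w' n p, fun n => ⟨(hw n).1.add (hw' n).1, (hw n).2.add (hw' n).2⟩,
    ?_, ?_, ?_, ?_⟩
  · exact tendsto_eLpNorm_add (fun n => (hw n).1.continuous.aestronglyMeasurable)
      (fun n => (hw' n).1.continuous.aestronglyMeasurable) h1 h1'
  · simp only [hder]
    exact tendsto_eLpNorm_add (fun n => (hcd _ _ (hw n).1).aestronglyMeasurable)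
      (fun n => (hcd _ _ (hw' n).1).aestronglyMeasurable) h2 h2'
  · simp only [hder]
    exact tendsto_eLpNorm_add (fun n => (hcd _ _ (hw n).1).aestronglyMeasurable)
      (fun n => (hcd _ _ (hw' n).1).aestronglyMeasurable) h3 h3'
  · exact tendsto_eLpNorm_add
      (fun n => ((hw n).1.continuous.comp hc).aestronglyMeasurable)
      (fun n => ((hw' n).1.continuous.comp hc).aestronglyMeasurable) h4 h4'

lemma HasTrace.smul {Ω : Set (ℝ × ℝ)} {c : ℝ → ℝ × ℝ} {I : Set ℝ}
    {F : Jet Ω} {g : L2line I} (k : ℂ) (h : HasTrace Ω c I F g) :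
    HasTrace Ω c I (k • F) (k • g) := by
  obtain ⟨w, hw, h1, h2, h3, h4⟩ := h
  have hder : ∀ n p e, fderiv ℝ (fun p => k * w n p) p e = k * fderiv ℝ (w n) p e :=
    fun n p e => by
      rw [fderiv_const_mul ((hw n).1.differentiable (by simp) p)]
      rfl
  refine ⟨fun n p => k * w n p, fun n => ⟨contDiff_const.mul (hw n).1, (hw n).2.mul_left⟩,
    tendsto_eLpNorm_smul k h1, ?_, ?_, tendsto_eLpNorm_smul k h4⟩
  · simp only [hder]
    exact tendsto_eLpNorm_smul k h2
  · simp only [hder]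
    exact tendsto_eLpNorm_smul k h3

lemma InFormDomain.add {d : ℝ} {F F' : FormData d} (h : InFormDomain d F)
    (h' : InFormDomain d F') : InFormDomain d (F + F') := by
  obtain ⟨⟨h1, h2⟩, h3, h4, h5, h6, h7⟩ := h
  obtain ⟨⟨h1', h2'⟩, h3', h4', h5', h6', h7'⟩ := h'
  refine ⟨⟨h1.add h1', h2.add h2'⟩, ?_, ?_, h5.add (by fun_prop) h5', h6.add (by fun_prop) h6',
    h7.add (by fun_prop) h7'⟩
  · simpa using h3.add (by fun_prop) h3'
  · simpa using h4.add (by fun_prop) h4'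

lemma InFormDomain.smul {d : ℝ} {F : FormData d} (k : ℂ) (h : InFormDomain d F) :
    InFormDomain d (k • F) := by
  obtain ⟨⟨h1, h2⟩, h3, h4, h5, h6, h7⟩ := h
  refine ⟨⟨h1.smul k, h2.smul k⟩, ?_, ?_, h5.smul k, h6.smul k, h7.smul k⟩
  · simpa using h3.smul k
  · simpa using h4.smul k

lemma integrable_potential_mul_inner (σ : Potential) {I : Set ℝ} (hI : I ⊆ Set.Ici 0)
    (a b : L2line I) :
    Integrable (fun y => (σ y : ℂ) * inner ℂ (a y) (b y)) (volume.restrict I) := by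
  have hσ : MemLp (fun y => (σ y : ℂ)) ∞ (volume.restrict I) :=
    ((Lp.memLp σ).mono_measure (Measure.restrict_mono hI le_rfl)).ofReal
  exact (memLp_one_iff_integrable.mp ((memLp_one_iff_integrable.mpr
    (L2.integrable_inner (𝕜 := ℂ) a b)).mul hσ))

lemma form_add (d : ℝ) (σ α : Potential) (G F F' : FormData d) :
    form d σ α G (F + F') = form d σ α G F + form d σ α G F' := by
  have hI : Set.Icc (0 : ℝ) d ⊆ Set.Ici 0 := fun y hy => hy.1
  have e1 : (∫ p in pencil d,
      (inner ℂ (G.1.2.1 p) ((F + F').1.2.1 p) + inner ℂ (G.1.2.2 p) ((F + F').1.2.2 p)))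
      = (∫ p in pencil d, (inner ℂ (G.1.2.1 p) (F.1.2.1 p) + inner ℂ (G.1.2.2 p) (F.1.2.2 p)))
      + ∫ p in pencil d,
        (inner ℂ (G.1.2.1 p) (F'.1.2.1 p) + inner ℂ (G.1.2.2 p) (F'.1.2.2 p)) := by
    rw [← integral_add ((L2.integrable_inner _ _).add (L2.integrable_inner _ _))
      ((L2.integrable_inner _ _).add (L2.integrable_inner _ _))]
    refine integral_congr_ae ?_
    filter_upwards [Lp.coeFn_add F.1.2.1 F'.1.2.1, Lp.coeFn_add F.1.2.2 F'.1.2.2] with p h1 h2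
    simp only [Prod.fst_add, Prod.snd_add, h1, h2, Pi.add_apply, inner_add_right]
    ring
  have e2 : (∫ y in Set.Icc 0 d, (σ y : ℂ) *
      (inner ℂ (G.2.1 y) ((F + F').2.1 y) + inner ℂ (G.2.2.1 y) ((F + F').2.2.1 y)))
      = (∫ y in Set.Icc 0 d,
        (σ y : ℂ) * (inner ℂ (G.2.1 y) (F.2.1 y) + inner ℂ (G.2.2.1 y) (F.2.2.1 y)))
      + ∫ y in Set.Icc 0 d,
        (σ y : ℂ) * (inner ℂ (G.2.1 y) (F'.2.1 y) + inner ℂ (G.2.2.1 y) (F'.2.2.1 y)) := by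
    have hi : ∀ a a' b b' : L2line (Set.Icc 0 d), Integrable
        (fun y => (σ y : ℂ) * (inner ℂ (a y) (b y) + inner ℂ (a' y) (b' y)))
        (volume.restrict (Set.Icc 0 d)) := fun a a' b b' => by
      simp only [mul_add]
      exact (integrable_potential_mul_inner σ hI _ _).add (integrable_potential_mul_inner σ hI _ _)
    rw [← integral_add (hi _ _ _ _) (hi _ _ _ _)]
    refine integral_congr_ae ?_
    filter_upwards [Lp.coeFn_add F.2.1 F'.2.1, Lp.coeFn_add F.2.2.1 F'.2.2.1] with p h1 h2
    simp only [Prod.fst_add, Prod.snd_add, h1, h2, Pi.add_apply, inner_add_right]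
    ring
  have e3 : (∫ y in Set.Ici 0, (α y : ℂ) * inner ℂ (G.2.2.2 y) ((F + F').2.2.2 y))
      = (∫ y in Set.Ici 0, (α y : ℂ) * inner ℂ (G.2.2.2 y) (F.2.2.2 y))
      + ∫ y in Set.Ici 0, (α y : ℂ) * inner ℂ (G.2.2.2 y) (F'.2.2.2 y) := by
    rw [← integral_add (integrable_potential_mul_inner α le_rfl _ _)
      (integrable_potential_mul_inner α le_rfl _ _)]
    refine integral_congr_ae ?_
    filter_upwards [Lp.coeFn_add F.2.2.2 F'.2.2.2] with p h1
    simp only [Prod.snd_add, h1, Pi.add_apply, inner_add_right]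
    ring
  unfold form
  rw [e1, e2, e3]
  ring

lemma form_smul (d : ℝ) (σ α : Potential) (G F : FormData d) (k : ℂ) :
    form d σ α G (k • F) = k * form d σ α G F := by
  have e1 : (∫ p in pencil d,
      (inner ℂ (G.1.2.1 p) ((k • F).1.2.1 p) + inner ℂ (G.1.2.2 p) ((k • F).1.2.2 p)))
      = k * ∫ p in pencil d,
        (inner ℂ (G.1.2.1 p) (F.1.2.1 p) + inner ℂ (G.1.2.2 p) (F.1.2.2 p)) := by
    rw [← integral_const_mul]
    refine integral_congr_ae ?_
    filter_upwards [Lp.coeFn_smul k F.1.2.1, Lp.coeFn_smul k F.1.2.2] with p h1 h2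
    simp only [Prod.smul_fst, Prod.smul_snd, h1, h2, Pi.smul_apply, inner_smul_right]
    ring
  have e2 : (∫ y in Set.Icc 0 d, (σ y : ℂ) *
      (inner ℂ (G.2.1 y) ((k • F).2.1 y) + inner ℂ (G.2.2.1 y) ((k • F).2.2.1 y)))
      = k * ∫ y in Set.Icc 0 d,
        (σ y : ℂ) * (inner ℂ (G.2.1 y) (F.2.1 y) + inner ℂ (G.2.2.1 y) (F.2.2.1 y)) := by
    rw [← integral_const_mul]
    refine integral_congr_ae ?_
    filter_upwards [Lp.coeFn_smul k F.2.1, Lp.coeFn_smul k F.2.2.1] with p h1 h2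
    simp only [Prod.smul_fst, Prod.smul_snd, h1, h2, Pi.smul_apply, inner_smul_right]
    ring
  have e3 : (∫ y in Set.Ici 0, (α y : ℂ) * inner ℂ (G.2.2.2 y) ((k • F).2.2.2 y))
      = k * ∫ y in Set.Ici 0, (α y : ℂ) * inner ℂ (G.2.2.2 y) (F.2.2.2 y) := by
    rw [← integral_const_mul]
    refine integral_congr_ae ?_
    filter_upwards [Lp.coeFn_smul k F.2.2.2] with p h1
    simp only [Prod.smul_snd, h1, Pi.smul_apply, inner_smul_right]
    ring
  unfold form
  rw [e1, e2, e3]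
  ring

lemma IsH1.zero (Ω : Set (ℝ × ℝ)) : IsH1 Ω 0 := by
  have key : ∀ θ : ℝ × ℝ → ℝ, (∫ p in Ω, θ p • (0 : L2 Ω) p) = 0 := fun θ => by
    rw [← integral_zero (ℝ × ℝ) ℂ (μ := volume.restrict Ω)]
    refine integral_congr_ae ?_
    filter_upwards [Lp.coeFn_zero ℂ 2 (volume.restrict Ω)] with p hp
    rw [hp, Pi.zero_apply, smul_zero]
  constructor <;> intro η _ _ _ <;> simp only [Prod.fst_zero, Prod.snd_zero, key, neg_zero]

lemma HasTrace.zero (Ω : Set (ℝ × ℝ)) (c : ℝ → ℝ × ℝ) (I : Set ℝ) : HasTrace Ω c I 0 0 := by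
  have key : ∀ {X : Type} [MeasurableSpace X] (μ : Measure X),
      Tendsto (fun _ : ℕ => eLpNorm (fun p => (0 : ℂ) - (0 : Lp ℂ 2 μ) p) 2 μ) atTop (𝓝 0) :=
    fun μ => by
      have : eLpNorm (fun p => (0 : ℂ) - (0 : Lp ℂ 2 μ) p) 2 μ = 0 := by
        rw [← eLpNorm_zero (p := 2) (μ := μ) (ε := ℂ)]
        refine eLpNorm_congr_ae ?_
        filter_upwards [Lp.coeFn_zero ℂ 2 μ] with p hp
        rw [hp]
        simp
      rw [this]
      exact tendsto_const_nhds
  refine ⟨fun _ _ => 0, fun _ => ⟨contDiff_const, HasCompactSupport.zero⟩, key _, ?_, ?_, key _⟩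
  · simpa using key _
  · simpa using key _

lemma InFormDomain.zero (d : ℝ) : InFormDomain d 0 :=
  ⟨IsH1.zero _, HasTrace.zero _ _ _, HasTrace.zero _ _ _, HasTrace.zero _ _ _,
    HasTrace.zero _ _ _, HasTrace.zero _ _ _⟩

/-- The graph of the operator of the form, as a subspace. -/
def operatorGraph (d : ℝ) (σ α : Potential) : Submodule ℂ (L2 (pencil d) × L2 (pencil d)) where
  carrier := {x | InOperatorGraph d σ α x.1 x.2}
  add_mem' := by
    rintro x x' ⟨F, hF, h1, h2⟩ ⟨F', hF', h1', h2'⟩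
    refine ⟨F + F', hF.add hF', by rw [Prod.fst_add, Prod.fst_add, h1, h1', Prod.fst_add],
      fun G hG => ?_⟩
    rw [form_add, h2 G hG, h2' G hG, Prod.snd_add, inner_add_right]
  zero_mem' := by
    refine ⟨0, InFormDomain.zero d, rfl, fun G _ => ?_⟩
    have := form_smul d σ α G 0 0
    rw [zero_smul, zero_mul] at this
    rw [this, Prod.snd_zero, inner_zero_right]
  smul_mem' := by
    rintro k x ⟨F, hF, h1, h2⟩
    refine ⟨k • F, hF.smul k, by rw [Prod.smul_fst, Prod.smul_fst, h1, Prod.smul_fst],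
      fun G hG => ?_⟩
    rw [form_smul, h2 G hG, Prod.smul_snd, inner_smul_right]

/-- The operator associated with the form by the representation theorem: its domain consists of
the `φ` in the form domain for which there is an `f` with `q(ψ, φ) = ⟨ψ, f⟩` for all `ψ` in the
form domain, and it sends such a `φ` to `f`. -/
def hamiltonian (d : ℝ) (σ α : Potential) : L2 (pencil d) →ₗ.[ℂ] L2 (pencil d) :=
  (operatorGraph d σ α).toLinearPMap

lemma convex_pencil (d : ℝ) : Convex ℝ (pencil d) := by
  rintro ⟨x, y⟩ ⟨h1, h2, h3⟩ ⟨x', y'⟩ ⟨h1', h2', h3'⟩ a b ha hb hab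
  simp only [abs_le] at h1 h2 h3 h1' h2' h3'
  simp only [pencil, Set.mem_ofPred_eq, Prod.fst_add, Prod.snd_add, Prod.smul_fst, Prod.smul_snd,
    smul_eq_mul, abs_le]
  refine ⟨by positivity, by positivity, ?_, ?_⟩
  · nlinarith [mul_le_mul_of_nonneg_left h3.1 ha, mul_le_mul_of_nonneg_left h3'.1 hb]
  · nlinarith [mul_le_mul_of_nonneg_left h3.2 ha, mul_le_mul_of_nonneg_left h3'.2 hb]

/-- An `L²` function that is orthogonal to all test functions supported in the interior of the
pencil and off the diagonal vanishes. -/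
lemma eq_zero_of_integral_test (d : ℝ) (u : L2 (pencil d))
    (h : ∀ η : ℝ × ℝ → ℝ, ContDiff ℝ ∞ η → HasCompactSupport η →
      tsupport η ⊆ interior (pencil d) \ {p | p.1 = p.2} → ∫ p in pencil d, η p • u p = 0) :
    u = 0 := by
  have hU : IsOpen (interior (pencil d) \ {p : ℝ × ℝ | p.1 = p.2}) :=
    isOpen_interior.sdiff (isClosed_eq continuous_fst continuous_snd)
  have hmain := hU.ae_eq_zero_of_integral_contDiff_smul_eq_zero (μ := volume.restrict (pencil d))
    (((Lp.memLp u).locallyIntegrable (by norm_num)).locallyIntegrableOn _) h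
  have hdiag : volume {p : ℝ × ℝ | p.1 = p.2} = 0 := by
    have := Measure.addHaar_submodule (volume : Measure (ℝ × ℝ))
      (LinearMap.ker (LinearMap.fst ℝ ℝ ℝ - LinearMap.snd ℝ ℝ ℝ)) (by
        intro htop
        have : ((1, 0) : ℝ × ℝ) ∈ LinearMap.ker (LinearMap.fst ℝ ℝ ℝ - LinearMap.snd ℝ ℝ ℝ) :=
          htop ▸ Submodule.mem_top
        simp at this)
    convert this using 2
    ext p
    simp [sub_eq_zero]
  have hfr : volume (frontier (pencil d)) = 0 := (convex_pencil d).addHaar_frontier volume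
  have h0 : ∀ᵐ p ∂(volume.restrict (pencil d)), p ∉ {p : ℝ × ℝ | p.1 = p.2} :=
    ae_restrict_of_ae (measure_eq_zero_iff_ae_notMem.mp hdiag)
  have h1 : ∀ᵐ p ∂(volume.restrict (pencil d)), p ∉ frontier (pencil d) :=
    ae_restrict_of_ae (measure_eq_zero_iff_ae_notMem.mp hfr)
  have hcl : IsClosed (pencil d) :=
    (isClosed_le continuous_const continuous_fst).inter
      ((isClosed_le continuous_const continuous_snd).inter
        (isClosed_le (f := fun p : ℝ × ℝ => |p.1 - p.2|) (by fun_prop) continuous_const))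
  rw [Lp.eq_zero_iff_ae_eq_zero]
  filter_upwards [hmain, h0, h1, ae_restrict_mem hcl.measurableSet] with p hp hp0 hp1 hp2
  refine hp ⟨?_, hp0⟩
  by_contra hi
  exact hp1 ⟨subset_closure hp2, hi⟩

/-- Test functions supported in the interior of the pencil and off the diagonal belong to the form
domain. -/
lemma exists_test_formData (d : ℝ) (η : ℝ × ℝ → ℝ) (h1 : ContDiff ℝ ∞ η)
    (h2 : HasCompactSupport η) (h3 : tsupport η ⊆ interior (pencil d) \ {p | p.1 = p.2}) :
    ∃ G : FormData d, InFormDomain d G ∧ G.2 = 0 ∧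
      (G.1.1 =ᵐ[volume.restrict (pencil d)] fun p => (η p : ℂ)) := by
  set ζ : ℝ × ℝ → ℂ := fun p => (η p : ℂ) with hζ
  have hζ1 : ContDiff ℝ ∞ ζ := Complex.ofRealCLM.contDiff.comp h1
  have hζ2 : HasCompactSupport ζ := h2.comp_left (g := fun r : ℝ => (r : ℂ)) (by simp)
  have hζd : ∀ e : ℝ × ℝ, Continuous fun p => fderiv ℝ ζ p e := fun e =>
    (hζ1.continuous_fderiv (by simp)).clm_apply continuous_const
  have hζds : ∀ e : ℝ × ℝ, HasCompactSupport fun p => fderiv ℝ ζ p e := fun e =>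
    (hζ2.fderiv (𝕜 := ℝ)).comp_left (g := fun L : ℝ × ℝ →L[ℝ] ℂ => L e) (by simp)
  have m0 : MemLp ζ 2 (volume.restrict (pencil d)) :=
    (hζ1.continuous.memLp_of_hasCompactSupport hζ2).restrict _
  have m1 : ∀ e : ℝ × ℝ, MemLp (fun p => fderiv ℝ ζ p e) 2 (volume.restrict (pencil d)) :=
    fun e => ((hζd e).memLp_of_hasCompactSupport (hζds e)).restrict _
  have hweak : ∀ e : ℝ × ℝ, IsWeakDeriv (pencil d) e (m0.toLp ζ) ((m1 e).toLp _) := by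
    intro e θ t1 t2 t3
    have td : Continuous fun p => fderiv ℝ θ p e :=
      (t1.continuous_fderiv (by simp)).clm_apply continuous_const
    have tds : HasCompactSupport fun p => fderiv ℝ θ p e :=
      (t2.fderiv (𝕜 := ℝ)).comp_left (g := fun L : ℝ × ℝ →L[ℝ] ℝ => L e) (by simp)
    have hz : ∀ p, p ∉ pencil d → θ p = 0 := fun p hp =>
      image_eq_zero_of_notMem_tsupport fun h => hp (interior_subset (t3 h))
    have hzd : ∀ p, p ∉ pencil d → fderiv ℝ θ p e = 0 := fun p hp => by
      have : p ∉ tsupport (fderiv ℝ θ) := fun h =>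
        hp (interior_subset (t3 (tsupport_fderiv_subset ℝ h)))
      rw [image_eq_zero_of_notMem_tsupport this]
      rfl
    have a1 : (∫ p in pencil d, fderiv ℝ θ p e • (m0.toLp ζ) p) = ∫ p, fderiv ℝ θ p e • ζ p := by
      rw [← setIntegral_eq_integral_of_forall_compl_eq_zero (s := pencil d)
        (f := fun p => fderiv ℝ θ p e • ζ p) (fun p hp => by simp only [hzd p hp, zero_smul])]
      refine integral_congr_ae ?_
      filter_upwards [m0.coeFn_toLp] with p hp
      rw [hp]
    have a2 : (∫ p in pencil d, θ p • ((m1 e).toLp _) p) = ∫ p, θ p • fderiv ℝ ζ p e := by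
      rw [← setIntegral_eq_integral_of_forall_compl_eq_zero (s := pencil d)
        (f := fun p => θ p • fderiv ℝ ζ p e) (fun p hp => by simp only [hz p hp, zero_smul])]
      refine integral_congr_ae ?_
      filter_upwards [(m1 e).coeFn_toLp] with p hp
      rw [hp]
    rw [a1, a2, eq_comm, neg_eq_iff_eq_neg]
    refine integral_smul_fderiv_eq_neg_fderiv_smul_of_integrable ?_ ?_ ?_
      (fun x _ => t1.differentiable (by simp) x) (fun x _ => hζ1.differentiable (by simp) x)
    · exact (td.smul hζ1.continuous).integrable_of_hasCompactSupport (tds.smul_right)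
    · exact (t1.continuous.smul (hζd e)).integrable_of_hasCompactSupport (t2.smul_right)
    · exact (t1.continuous.smul hζ1.continuous).integrable_of_hasCompactSupport (t2.smul_right)
  have htr : ∀ (c : ℝ → ℝ × ℝ) (I : Set ℝ),
      (∀ t, c t ∉ interior (pencil d) \ {p : ℝ × ℝ | p.1 = p.2}) →
      HasTrace (pencil d) c I (m0.toLp ζ, (m1 (1, 0)).toLp _, (m1 (0, 1)).toLp _) 0 := by
    intro c I hc
    have zero_of : ∀ {X : Type} [MeasurableSpace X] (μ : Measure X) (f g : X → ℂ),
        f =ᵐ[μ] g → Tendsto (fun _ : ℕ => eLpNorm (fun p => f p - g p) 2 μ) atTop (𝓝 0) :=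
      fun μ f g hfg => by
        have : eLpNorm (fun p => f p - g p) 2 μ = 0 := by
          rw [← eLpNorm_zero (p := 2) (μ := μ) (ε := ℂ)]
          refine eLpNorm_congr_ae ?_
          filter_upwards [hfg] with p hp
          rw [hp, sub_self]
          rfl
        rw [this]
        exact tendsto_const_nhds
    refine ⟨fun _ => ζ, fun _ => ⟨hζ1, hζ2⟩, zero_of _ _ _ m0.coeFn_toLp.symm,
      zero_of _ _ _ (m1 (1, 0)).coeFn_toLp.symm, zero_of _ _ _ (m1 (0, 1)).coeFn_toLp.symm,
      zero_of _ _ _ ?_⟩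
    filter_upwards [Lp.coeFn_zero ℂ 2 (volume.restrict I)] with t ht
    rw [ht, hζ]
    simp only [Pi.zero_apply, Complex.ofReal_eq_zero]
    exact image_eq_zero_of_notMem_tsupport fun h => hc t (h3 h)
  have hint : ∀ p ∈ interior (pencil d), 0 < p.1 ∧ 0 < p.2 ∧ p.1 - p.2 < d ∧ p.2 - p.1 < d := by
    intro p hp
    have hev : ∀ v : ℝ × ℝ, ∃ s : ℝ, 0 < s ∧ p + s • v ∈ pencil d := by
      intro v
      have ht : Tendsto (fun s : ℝ => p + s • v) (𝓝[>] 0) (𝓝 p) := by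
        have : Continuous fun s : ℝ => p + s • v := by fun_prop
        have h := (this.tendsto 0).mono_left (nhdsWithin_le_nhds (s := Set.Ioi 0))
        simpa using h
      have := (ht.eventually (mem_interior_iff_mem_nhds.mp hp)).and self_mem_nhdsWithin
      obtain ⟨s, hs, hs'⟩ := this.exists
      exact ⟨s, hs', hs⟩
    obtain ⟨s, hs, a⟩ := hev (-1, 0)
    obtain ⟨s', hs', a'⟩ := hev (0, -1)
    simp only [pencil, Set.mem_ofPred_eq, Prod.fst_add, Prod.snd_add, Prod.smul_fst,
      Prod.smul_snd, smul_eq_mul, abs_le] at a a'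
    obtain ⟨b1, b2, b3, b4⟩ := a
    obtain ⟨b1', b2', b3', b4'⟩ := a'
    refine ⟨?_, ?_, ?_, ?_⟩ <;> linarith
  refine ⟨((m0.toLp ζ, (m1 (1, 0)).toLp _, (m1 (0, 1)).toLp _), 0), ⟨⟨hweak _, hweak _⟩,
    htr _ _ ?_, htr _ _ ?_, htr _ _ ?_, htr _ _ ?_, htr _ _ ?_⟩, rfl, m0.coeFn_toLp⟩
  · rintro t ⟨h, -⟩
    have := hint _ h
    simp at this
  · rintro t ⟨h, -⟩
    have := hint _ h
    simp at this
  · rintro t ⟨h, -⟩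
    have := hint _ h
    simp at this
  · rintro t ⟨h, -⟩
    have := hint _ h
    simp at this
  · rintro t ⟨-, h⟩
    exact h rfl

/-- The operator of the form is well defined: its graph is single-valued. -/
theorem operatorGraph_single_valued (d : ℝ) (σ α : Potential)
    (x : L2 (pencil d) × L2 (pencil d)) (hx : x ∈ operatorGraph d σ α) (hx' : x.1 = 0) :
    x.2 = 0 := by
  obtain ⟨F, hF, e1, e2⟩ := hx
  rw [hx'] at e1
  have hgrad : ∀ (e : ℝ × ℝ) (v : L2 (pencil d)), IsWeakDeriv (pencil d) e F.1.1 v → v = 0 := by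
    intro e v hv
    refine eq_zero_of_integral_test d v fun η h1 h2 h3 => ?_
    have := hv η h1 h2 (h3.trans Set.sdiff_subset)
    rw [e1] at this
    have hz : (∫ p in pencil d, fderiv ℝ η p e • (0 : L2 (pencil d)) p) = 0 := by
      rw [← integral_zero (ℝ × ℝ) ℂ (μ := volume.restrict (pencil d))]
      refine integral_congr_ae ?_
      filter_upwards [Lp.coeFn_zero ℂ 2 (volume.restrict (pencil d))] with p hp
      rw [hp, Pi.zero_apply, smul_zero]
    rw [hz] at this
    exact neg_eq_zero.mp this.symm
  have hx1 := hgrad _ _ hF.1.1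
  have hy1 := hgrad _ _ hF.1.2
  refine eq_zero_of_integral_test d x.2 fun η h1 h2 h3 => ?_
  obtain ⟨G, hG, hG0, hGη⟩ := exists_test_formData d η h1 h2 h3
  have hq := e2 G hG
  have hform : form d σ α G F = 0 := by
    have z : ∀ {X : Type} [MeasurableSpace X] (μ : Measure X),
        ∀ᵐ p ∂μ, (0 : Lp ℂ 2 μ) p = 0 := fun μ => Lp.coeFn_zero ℂ 2 μ
    unfold form
    rw [hG0, hx1, hy1]
    have i1 : (∫ p in pencil d, (inner ℂ (G.1.2.1 p) ((0 : L2 (pencil d)) p)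
        + inner ℂ (G.1.2.2 p) ((0 : L2 (pencil d)) p))) = 0 := by
      refine integral_eq_zero_of_ae ?_
      filter_upwards [z (volume.restrict (pencil d))] with p hp
      simp only [hp, inner_zero_right, add_zero, Pi.zero_apply]
    have i2 : (∫ y in Set.Icc 0 d, (σ y : ℂ) * (inner ℂ ((0 : L2line (Set.Icc 0 d)) y) (F.2.1 y)
        + inner ℂ ((0 : L2line (Set.Icc 0 d)) y) (F.2.2.1 y))) = 0 := by
      refine integral_eq_zero_of_ae ?_
      filter_upwards [z (volume.restrict (Set.Icc 0 d))] with p hp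
      simp only [hp, inner_zero_left, add_zero, mul_zero, Pi.zero_apply]
    have i3 : (∫ y in Set.Ici 0, (α y : ℂ) * inner ℂ ((0 : L2line (Set.Ici 0)) y) (F.2.2.2 y))
        = 0 := by
      refine integral_eq_zero_of_ae ?_
      filter_upwards [z (volume.restrict (Set.Ici (0 : ℝ)))] with p hp
      simp only [hp, inner_zero_left, mul_zero, Pi.zero_apply]
    simp only [Prod.fst_zero, Prod.snd_zero]
    rw [i1, i2, i3]
    simp
  rw [hform, L2.inner_def] at hq
  rw [hq]
  refine integral_congr_ae ?_
  filter_upwards [hGη] with p hp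
  rw [hp]
  simp [mul_comm]

end PencilModel
end

/-!
Write `a = π / (2 d)` and `E₀ = 2 a² = π² / (2 d²)` (`threshold`). Far from the corner the pencil is
a strip of width `√2 d` with Dirichlet sides, whose transverse ground state `cos (a (x - y))` has
energy `E₀`. The theorem holds because a strong repulsion on the two legs lifts the form above `E₀`,
while every energy above `E₀` remains in the spectrum. An eigenvalue is then real and at least `E₀`,
and it has other points of the spectrum arbitrarily close to it.

*Lower bound* (`threshold_mul_add_le_form_self`). The pencil is cut along `x = y` and `x + y = d`
into two triangles and two half-strips. Each of the four pieces is swept by parallel segments that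
issue from a curve on which a trace is prescribed: a leg in the case of a triangle, a Dirichlet side
in the case of a half-strip. On a segment of length `m ≤ L` one has, for `b L < π / 2`,
`b² ∫ |v|² ≤ ∫ |v'|² + b tan (b L) |v 0|²` (`mul_integral_norm_sq_le_of_slice`), since the
difference of the integrands is `|v' - p v|²` up to the derivative of `p |v|²`,
with `p u = b tan (b (L - u))`. The segments in a triangle have length at most `d / 2`, so that
`b² = E₀` is allowed there: the derivative in one direction suffices, and the boundary term is paid
for by the repulsion, of strength `couplingBound`. In a half-strip the trace vanishes and `b` tends
to `a`; the derivative across the strip accounts for `2 b²`. Each piece involves one trace only,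
hence only one sequence of smooth approximations, and no trace theorem is needed.

*Spectrum* (`ofReal_mem_spectrum`). For `E ≥ E₀` let `k² = 2 (E - E₀)`. The modes
`φ = f ((x + y) / 2) cos (a (x - y))`, with `f` a slowly modulated plane wave `exp (i k c)` supported
far out, satisfy `|q(φ, F) - E ⟨φ, F⟩| ≤ δ ‖φ‖ (‖F‖ + (∫ α |F(y, y)|² dy)^{1/2})` for all `F` in the
form domain (`exists_quasimode`). This follows from Green's identity
(`setIntegral_pencil_green`) and from `α → 0`. The identity is proved on each half-strip
separately: on the diagonal the normal derivative of the mode vanishes, and on the side the trace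
of `F` does. If `A - E` had a bounded inverse `R`, then `F = R φ` would give
`q(φ, F) - E ⟨φ, F⟩ = ‖φ‖²`, while `‖F‖` and, by the lower bound, `∫ α |F(y, y)|² dy` are controlled
by `‖φ‖`; for small `δ` this is a contradiction.
-/

noncomputable section

namespace PencilModel

/-! ### Norms and pairings under `L²` convergence, and the inequality on a segment -/

theorem tendsto_toLp_of_tendsto_eLpNorm {X : Type*} [MeasurableSpace X] {μ : Measure X}
    {f : X → ℂ} {w : ℕ → X → ℂ} (hw : ∀ n, MemLp (w n) 2 μ) (hf : MemLp f 2 μ)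
    (h : Tendsto (fun n => eLpNorm (fun x => w n x - f x) 2 μ) atTop (𝓝 0)) :
    Tendsto (fun n => (hw n).toLp (w n)) atTop (𝓝 (hf.toLp f)) :=
  (Lp.tendsto_Lp_iff_tendsto_eLpNorm'' w hw f hf).mpr h

theorem integral_norm_sq_eq_norm_toLp {X : Type*} [MeasurableSpace X] {μ : Measure X}
    {f : X → ℂ} (hf : MemLp f 2 μ) : ∫ x, ‖f x‖ ^ 2 ∂μ = ‖hf.toLp f‖ ^ 2 := by
  have h : (inner ℂ (hf.toLp f) (hf.toLp f) : ℂ) = ((∫ x, ‖f x‖ ^ 2 ∂μ : ℝ) : ℂ) := by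
    rw [L2.inner_def, ← integral_complex_ofReal]
    refine integral_congr_ae ?_
    filter_upwards [hf.coeFn_toLp] with x hx
    rw [hx, inner_self_eq_norm_sq_to_K]
    simp
  rw [inner_self_eq_norm_sq_to_K] at h
  refine Complex.ofReal_injective ?_
  rw [← h]
  simp

theorem tendsto_integral_norm_sq_of_tendsto_eLpNorm {X : Type*} [MeasurableSpace X]
    {μ : Measure X} {f : X → ℂ} {w : ℕ → X → ℂ} (hw : ∀ n, MemLp (w n) 2 μ) (hf : MemLp f 2 μ)
    (h : Tendsto (fun n => eLpNorm (fun x => w n x - f x) 2 μ) atTop (𝓝 0)) :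
    Tendsto (fun n => ∫ x, ‖w n x‖ ^ 2 ∂μ) atTop (𝓝 (∫ x, ‖f x‖ ^ 2 ∂μ)) := by
  simp only [fun n => integral_norm_sq_eq_norm_toLp (hw n), integral_norm_sq_eq_norm_toLp hf]
  exact ((tendsto_toLp_of_tendsto_eLpNorm hw hf h).norm).pow 2

theorem tendsto_integral_mul_of_tendsto_eLpNorm {X : Type*} [MeasurableSpace X]
    {μ : Measure X} {g f : X → ℂ} {w : ℕ → X → ℂ} (hg : MemLp g 2 μ)
    (hw : ∀ n, MemLp (w n) 2 μ) (hf : MemLp f 2 μ)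
    (h : Tendsto (fun n => eLpNorm (fun x => w n x - f x) 2 μ) atTop (𝓝 0)) :
    Tendsto (fun n => ∫ x, g x * w n x ∂μ) atTop (𝓝 (∫ x, g x * f x ∂μ)) := by
  have hg' : MemLp (fun x => star (g x)) 2 μ := hg.star
  have key : ∀ {v : X → ℂ} (hv : MemLp v 2 μ),
      ∫ x, g x * v x ∂μ = inner ℂ (hg'.toLp _) (hv.toLp v) := by
    intro v hv
    rw [L2.inner_def]
    refine integral_congr_ae ?_
    filter_upwards [hg'.coeFn_toLp, hv.coeFn_toLp] with x h1 h2
    rw [h1, h2]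
    simp [mul_comm]
  simp only [fun n => key (hw n), key hf]
  exact (tendsto_const_nhds).inner (tendsto_toLp_of_tendsto_eLpNorm hw hf h)

/-- The Poincaré inequality on a segment with a Robin condition at the end `0` and none at the end
`m`. The function `p u = b tan (b (L - u))` solves `p' + p² = -b²` and is nonnegative up to `L`, so
that the boundary term at `m` can be dropped. -/
theorem mul_integral_norm_sq_le_of_slice {v v' : ℝ → ℂ} (hv : ∀ u, HasDerivAt v (v' u) u)
    (hv' : Continuous v') {b L m : ℝ} (hb : 0 ≤ b) (hbL : b * L < Real.pi / 2)
    (hm : 0 ≤ m) (hmL : m ≤ L) :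
    b ^ 2 * ∫ u in (0)..m, ‖v u‖ ^ 2
      ≤ (∫ u in (0)..m, ‖v' u‖ ^ 2) + b * Real.tan (b * L) * ‖v 0‖ ^ 2 := by
  have hvc : Continuous v := continuous_iff_continuousAt.mpr fun u => (hv u).continuousAt
  set p : ℝ → ℝ := fun u => b * Real.tan (b * (L - u)) with hp
  have hang : ∀ u ∈ Set.uIcc 0 m, 0 ≤ b * (L - u) ∧ b * (L - u) < Real.pi / 2 := by
    intro u hu
    rw [Set.uIcc_of_le hm] at hu
    have h1 : 0 ≤ L - u := by linarith [hu.2]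
    exact ⟨mul_nonneg hb h1, by nlinarith [hu.1]⟩
  have hcos : ∀ u ∈ Set.uIcc 0 m, Real.cos (b * (L - u)) ≠ 0 := fun u hu =>
    (Real.cos_pos_of_mem_Ioo ⟨by linarith [(hang u hu).1, Real.pi_pos], (hang u hu).2⟩).ne'
  have hpd : ∀ u ∈ Set.uIcc 0 m, HasDerivAt p (-(b ^ 2 + p u ^ 2)) u := by
    intro u hu
    have h1 : HasDerivAt (fun u => b * (L - u)) (-b) u := by
      simpa using ((hasDerivAt_id u).const_sub L).const_mul b
    have h2 := ((Real.hasDerivAt_tan (hcos u hu)).comp u h1).const_mul b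
    refine h2.congr_deriv ?_
    simp only [hp, Real.tan_eq_sin_div_cos]
    have := Real.sin_sq_add_cos_sq (b * (L - u))
    field_simp [hcos u hu]
    linear_combination b ^ 2 * this
  have hpc : ContinuousOn p (Set.uIcc 0 m) := fun u hu => (hpd u hu).continuousAt.continuousWithinAt
  have hH : ∀ u ∈ Set.uIcc 0 m, HasDerivAt (fun u => p u * ‖v u‖ ^ 2)
      (-(b ^ 2 + p u ^ 2) * ‖v u‖ ^ 2 + p u * (2 * inner ℝ (v u) (v' u))) u := fun u hu =>
    (hpd u hu).mul (hv u).norm_sq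
  have hHc : ContinuousOn (fun u => -(b ^ 2 + p u ^ 2) * ‖v u‖ ^ 2
      + p u * (2 * inner ℝ (v u) (v' u))) (Set.uIcc 0 m) := by
    have h1 : Continuous fun u => (inner ℝ (v u) (v' u) : ℝ) := hvc.inner hv'
    fun_prop
  have hftc := intervalIntegral.integral_eq_sub_of_hasDerivAt hH hHc.intervalIntegrable
  have hle : ∫ u in (0)..m, (-(b ^ 2 + p u ^ 2) * ‖v u‖ ^ 2 + p u * (2 * inner ℝ (v u) (v' u)))
      ≤ ∫ u in (0)..m, (‖v' u‖ ^ 2 - b ^ 2 * ‖v u‖ ^ 2) := by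
    refine intervalIntegral.integral_mono_on hm hHc.intervalIntegrable
      (Continuous.intervalIntegrable (by fun_prop) _ _) fun u hu => ?_
    -- the difference of the two sides is `‖v' - p v‖²`
    have h1 := norm_sub_sq_real (v' u) (p u • v u)
    rw [norm_smul, mul_pow, Real.norm_eq_abs, sq_abs, real_inner_smul_right,
      real_inner_comm] at h1
    nlinarith [sq_nonneg ‖v' u - p u • v u‖]
  rw [hftc, intervalIntegral.integral_sub (Continuous.intervalIntegrable (by fun_prop) _ _)
    (Continuous.intervalIntegrable (by fun_prop) _ _),
    intervalIntegral.integral_const_mul] at hle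
  have hpm : 0 ≤ p m := mul_nonneg hb (Real.tan_nonneg_of_nonneg_of_le_pi_div_two
    (hang m Set.right_mem_uIcc).1 (hang m Set.right_mem_uIcc).2.le)
  have hp0 : p 0 = b * Real.tan (b * L) := by simp [hp]
  rw [← hp0]
  have := mul_nonneg hpm (sq_nonneg ‖v m‖)
  linarith

/-! ### Unimodular coordinates -/

section

/-- The affine coordinates `(r, u) ↦ o + r e₁ + u e₂` of the plane with origin `o` and axes
`e₁`, `e₂`. -/
def frame (o e₁ e₂ : ℝ × ℝ) (q : ℝ × ℝ) : ℝ × ℝ := o + q.1 • e₁ + q.2 • e₂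

/-- The axes `e₁`, `e₂` span a parallelogram of area `1`. -/
def IsUnimodular (e₁ e₂ : ℝ × ℝ) : Prop := (e₁.1 * e₂.2 - e₁.2 * e₂.1) ^ 2 = 1

variable {o e₁ e₂ : ℝ × ℝ}

theorem contDiff_frame : ContDiff ℝ ∞ (frame o e₁ e₂) := by
  unfold frame
  fun_prop

theorem hasFDerivAt_frame (q : ℝ × ℝ) : HasFDerivAt (frame o e₁ e₂)
    ((ContinuousLinearMap.fst ℝ ℝ ℝ).smulRight e₁ + (ContinuousLinearMap.snd ℝ ℝ ℝ).smulRight e₂)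
    q := by
  unfold frame
  exact (((ContinuousLinearMap.fst ℝ ℝ ℝ).smulRight e₁).hasFDerivAt.const_add o).add
    ((ContinuousLinearMap.snd ℝ ℝ ℝ).smulRight e₂).hasFDerivAt

theorem fderiv_comp_frame {w : ℝ × ℝ → ℂ} (hw : ContDiff ℝ ∞ w) (q v : ℝ × ℝ) :
    fderiv ℝ (w ∘ frame o e₁ e₂) q v = fderiv ℝ w (frame o e₁ e₂ q) (v.1 • e₁ + v.2 • e₂) := by
  rw [((hw.differentiable (by simp) _).hasFDerivAt.comp q (hasFDerivAt_frame q)).fderiv]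
  rfl

/-- Unimodular coordinates as a homeomorphism of the plane. -/
def frameHomeomorph (o : ℝ × ℝ) (h : IsUnimodular e₁ e₂) : (ℝ × ℝ) ≃ₜ (ℝ × ℝ) where
  toFun := frame o e₁ e₂
  invFun p := ((e₁.1 * e₂.2 - e₁.2 * e₂.1) * ((p.1 - o.1) * e₂.2 - (p.2 - o.2) * e₂.1),
    (e₁.1 * e₂.2 - e₁.2 * e₂.1) * (e₁.1 * (p.2 - o.2) - e₁.2 * (p.1 - o.1)))
  left_inv q := by
    have h : (e₁.1 * e₂.2 - e₁.2 * e₂.1) ^ 2 = 1 := h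
    ext <;> simp only [frame, Prod.fst_add, Prod.snd_add, Prod.smul_fst, Prod.smul_snd,
      smul_eq_mul]
    · linear_combination q.1 * h
    · linear_combination q.2 * h
  right_inv p := by
    have h : (e₁.1 * e₂.2 - e₁.2 * e₂.1) ^ 2 = 1 := h
    ext <;> simp only [frame, Prod.fst_add, Prod.snd_add, Prod.smul_fst, Prod.smul_snd,
      smul_eq_mul]
    · linear_combination (p.1 - o.1) * h
    · linear_combination (p.2 - o.2) * h
  continuous_toFun := contDiff_frame.continuous
  continuous_invFun := by fun_prop

theorem measurableEmbedding_frame (h : IsUnimodular e₁ e₂) :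
    MeasurableEmbedding (frame o e₁ e₂) :=
  (frameHomeomorph o h).measurableEmbedding

theorem measurePreserving_frame (h : IsUnimodular e₁ e₂) :
    MeasurePreserving (frame o e₁ e₂) := by
  set M : Matrix (Fin 2) (Fin 2) ℝ := !![e₁.1, e₂.1; e₁.2, e₂.2] with hM
  set T : (ℝ × ℝ) →ₗ[ℝ] (ℝ × ℝ) :=
    Matrix.toLin (Module.Basis.finTwoProd ℝ) (Module.Basis.finTwoProd ℝ) M with hT
  have hdet : LinearMap.det T ^ 2 = 1 := by
    rw [hT, LinearMap.det_toLin, hM, Matrix.det_fin_two_of]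
    have h : (e₁.1 * e₂.2 - e₁.2 * e₂.1) ^ 2 = 1 := h
    linear_combination h
  have hdet' : |(LinearMap.det T)⁻¹| = 1 := by
    have h1 : |LinearMap.det T| = |1| := (sq_eq_sq_iff_abs_eq_abs _ _).mp (by rw [hdet, one_pow])
    rw [abs_inv, h1]
    simp
  have hne : LinearMap.det T ≠ 0 := by
    intro h0
    rw [h0] at hdet
    norm_num at hdet
  have hT' : MeasurePreserving (T : ℝ × ℝ → ℝ × ℝ) := by
    refine ⟨(LinearMap.continuous_of_finiteDimensional T).measurable, ?_⟩
    rw [Measure.map_linearMap_addHaar_eq_smul_addHaar _ hne, hdet']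
    simp
  have heq : frame o e₁ e₂ = (fun p => o + p) ∘ T := by
    funext q
    simp [frame, hT, hM, Matrix.toLin_finTwoProd_apply, add_assoc, Prod.ext_iff, mul_comm]
  rw [heq]
  exact (measurePreserving_add_left volume o).comp hT'

theorem setIntegral_comp_frame {E : Type*} [NormedAddCommGroup E] [NormedSpace ℝ E]
    (h : IsUnimodular e₁ e₂) (R : Set (ℝ × ℝ)) (f : ℝ × ℝ → E) :
    ∫ p in R, f p = ∫ q in frame o e₁ e₂ ⁻¹' R, f (frame o e₁ e₂ q) :=
  ((measurePreserving_frame h).setIntegral_preimage_emb (measurableEmbedding_frame h) f R).symm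

/-- Fubini in unimodular coordinates, over a region that is cut by the lines `r = const` in the
segments `0 ≤ u ≤ m r`. -/
theorem setIntegral_eq_integral_slices (h : IsUnimodular e₁ e₂) {R : Set (ℝ × ℝ)}
    (hR : MeasurableSet R) {I : Set ℝ} (hI : MeasurableSet I) {m : ℝ → ℝ}
    (hm : ∀ r ∈ I, 0 ≤ m r)
    (hslice : ∀ r u, frame o e₁ e₂ (r, u) ∈ R ↔ r ∈ I ∧ u ∈ Set.Icc 0 (m r))
    {f : ℝ × ℝ → ℝ} (hf : Continuous f) (hfs : HasCompactSupport f) :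
    ∫ p in R, f p = ∫ r in I, ∫ u in (0)..m r, f (frame o e₁ e₂ (r, u)) ∧
    IntegrableOn (fun r => ∫ u in (0)..m r, f (frame o e₁ e₂ (r, u))) I := by
  have hc : Continuous (f ∘ frame o e₁ e₂) := hf.comp contDiff_frame.continuous
  have hcs : HasCompactSupport (f ∘ frame o e₁ e₂) :=
    hfs.comp_homeomorph (frameHomeomorph o h)
  have hR' : MeasurableSet (frame o e₁ e₂ ⁻¹' R) :=
    hR.preimage (measurableEmbedding_frame h).measurable
  set F : ℝ × ℝ → ℝ := (frame o e₁ e₂ ⁻¹' R).indicator (f ∘ frame o e₁ e₂) with hF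
  have hint : Integrable F := (hc.integrable_of_hasCompactSupport hcs).indicator hR'
  have hFapp : ∀ r u, F (r, u)
      = I.indicator (fun r => (Set.Icc 0 (m r)).indicator (fun u => f (frame o e₁ e₂ (r, u))) u)
        r := by
    intro r u
    by_cases hmem : frame o e₁ e₂ (r, u) ∈ R
    · rw [hF, Set.indicator_of_mem (show (r, u) ∈ _ from hmem),
        Set.indicator_of_mem ((hslice r u).mp hmem).1,
        Set.indicator_of_mem ((hslice r u).mp hmem).2, Function.comp_apply]
    · rw [hF, Set.indicator_of_notMem (show (r, u) ∉ _ from hmem)]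
      by_cases hr : r ∈ I
      · rw [Set.indicator_of_mem hr, Set.indicator_of_notMem fun hu =>
          hmem ((hslice r u).mpr ⟨hr, hu⟩)]
      · rw [Set.indicator_of_notMem hr]
  have hin : (fun r => ∫ u, F (r, u))
      = I.indicator fun r => ∫ u in (0)..m r, f (frame o e₁ e₂ (r, u)) := by
    funext r
    by_cases hr : r ∈ I
    · rw [Set.indicator_of_mem hr, intervalIntegral.integral_of_le (hm r hr),
        ← integral_Icc_eq_integral_Ioc, ← integral_indicator measurableSet_Icc]
      simp only [hFapp, Set.indicator_of_mem hr]
    · rw [Set.indicator_of_notMem hr]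
      simp only [hFapp, Set.indicator_of_notMem hr, integral_zero]
  rw [Measure.volume_eq_prod] at hint
  constructor
  · rw [setIntegral_comp_frame h, ← integral_indicator hR', ← integral_indicator hI, ← hin,
      ← integral_prod F hint]
    rfl
  · rw [← integrable_indicator_iff hI, ← hin]
    exact hint.integral_prod_left

end

/-! ### The inequality on a swept region -/

section

variable {o e₁ e₂ : ℝ × ℝ}

theorem continuous_fderiv_apply {w : ℝ × ℝ → ℂ} (hw : ContDiff ℝ ∞ w) (e : ℝ × ℝ) :
    Continuous fun p => fderiv ℝ w p e :=
  (hw.continuous_fderiv (by simp)).clm_apply continuous_const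

theorem hasCompactSupport_fderiv_apply {w : ℝ × ℝ → ℂ} (hw : HasCompactSupport w) (e : ℝ × ℝ) :
    HasCompactSupport fun p => fderiv ℝ w p e :=
  (hw.fderiv (𝕜 := ℝ)).comp_left (g := fun L : ℝ × ℝ →L[ℝ] ℂ => L e) (by simp)

theorem fderiv_apply_eq (w : ℝ × ℝ → ℂ) (p e : ℝ × ℝ) :
    fderiv ℝ w p e = (e.1 : ℂ) * fderiv ℝ w p (1, 0) + (e.2 : ℂ) * fderiv ℝ w p (0, 1) := by
  have : e = e.1 • ((1, 0) : ℝ × ℝ) + e.2 • ((0, 1) : ℝ × ℝ) := by ext <;> simp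
  conv_lhs => rw [this]
  rw [map_add, map_smul, map_smul, Complex.real_smul, Complex.real_smul]

theorem hasCompactSupport_norm_sq {X : Type*} [TopologicalSpace X] {w : X → ℂ}
    (hw : HasCompactSupport w) : HasCompactSupport fun p => ‖w p‖ ^ 2 :=
  hw.comp_left (g := fun z : ℂ => ‖z‖ ^ 2) (by simp)

theorem hasCompactSupport_frame_line (h : IsUnimodular e₁ e₂) {w : ℝ × ℝ → ℂ}
    (hw : HasCompactSupport w) : HasCompactSupport fun r : ℝ => w (frame o e₁ e₂ (r, 0)) := by
  have hcs : HasCompactSupport (w ∘ frame o e₁ e₂) := hw.comp_homeomorph (frameHomeomorph o h)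
  refine HasCompactSupport.intro (hcs.isCompact.image continuous_fst) fun r hr => ?_
  by_contra hne
  exact hr ⟨(r, 0), subset_tsupport _ hne, rfl⟩

/-- A region that is swept by segments of length at most `L` issuing from a curve: in unimodular
coordinates it is `{(r, u) : r ∈ I, 0 ≤ u ≤ m r}` with `m ≤ L`. -/
structure IsSwept (o e₁ e₂ : ℝ × ℝ) (R : Set (ℝ × ℝ)) (I : Set ℝ) (L : ℝ) (m : ℝ → ℝ) :
    Prop where
  unimodular : IsUnimodular e₁ e₂
  measurableSet : MeasurableSet R
  measurableSet_base : MeasurableSet I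
  nonneg : ∀ r ∈ I, 0 ≤ m r
  le : ∀ r ∈ I, m r ≤ L
  mem_iff : ∀ r u, frame o e₁ e₂ (r, u) ∈ R ↔ r ∈ I ∧ u ∈ Set.Icc 0 (m r)

theorem IsSwept.mul_setIntegral_norm_sq_le_of_contDiff {R : Set (ℝ × ℝ)} {I : Set ℝ} {L : ℝ}
    {m : ℝ → ℝ} (h : IsSwept o e₁ e₂ R I L m) {b : ℝ} (hb : 0 ≤ b) (hbL : b * L < Real.pi / 2)
    {w : ℝ × ℝ → ℂ} (hw : ContDiff ℝ ∞ w) (hws : HasCompactSupport w) :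
    b ^ 2 * ∫ p in R, ‖w p‖ ^ 2 ≤ (∫ p in R, ‖fderiv ℝ w p e₂‖ ^ 2)
      + b * Real.tan (b * L) * ∫ r in I, ‖w (frame o e₁ e₂ (r, 0))‖ ^ 2 := by
  obtain ⟨hu, hR, hI, hm, hmL, hsl⟩ := h
  have hc0 := hw.continuous
  have hc1 := continuous_fderiv_apply hw e₂
  obtain ⟨a1, a2⟩ := setIntegral_eq_integral_slices hu hR hI hm hsl
    (f := fun p => ‖w p‖ ^ 2) (by fun_prop) (hasCompactSupport_norm_sq hws)
  obtain ⟨b1, b2⟩ := setIntegral_eq_integral_slices hu hR hI hm hsl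
    (f := fun p => ‖fderiv ℝ w p e₂‖ ^ 2) (by fun_prop)
    (hasCompactSupport_norm_sq (hasCompactSupport_fderiv_apply hws e₂))
  have hfc : Continuous (frame o e₁ e₂) := contDiff_frame.continuous
  have hline : IntegrableOn (fun r => b * Real.tan (b * L) * ‖w (frame o e₁ e₂ (r, 0))‖ ^ 2) I :=
    ((Continuous.integrable_of_hasCompactSupport (by fun_prop)
      (hasCompactSupport_norm_sq (hasCompactSupport_frame_line hu hws))).const_mul _).integrableOn
  rw [a1, b1, ← integral_const_mul, ← integral_const_mul, ← integral_add b2 hline]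
  refine setIntegral_mono_on (a2.const_mul _) (b2.add hline) hI fun r hr => ?_
  refine mul_integral_norm_sq_le_of_slice (v := fun u => w (frame o e₁ e₂ (r, u))) (fun u => ?_)
    (by fun_prop) hb hbL (hm r hr) (hmL r hr)
  have h1 : HasDerivAt (fun u : ℝ => frame o e₁ e₂ (r, u)) e₂ u := by
    have := ((hasDerivAt_id u).smul_const e₂).const_add (o + r • e₁)
    simpa [frame] using this
  exact (hw.differentiable (by simp) _).hasFDerivAt.comp_hasDerivAt u h1

theorem tendsto_eLpNorm_restrict {X : Type*} [MeasurableSpace X] {μ ν : Measure X} (hμ : ν ≤ μ)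
    {f : ℕ → X → ℂ} (h : Tendsto (fun n => eLpNorm (f n) 2 μ) atTop (𝓝 0)) :
    Tendsto (fun n => eLpNorm (f n) 2 ν) atTop (𝓝 0) :=
  tendsto_of_tendsto_of_tendsto_of_le_of_le tendsto_const_nhds h (fun _ => zero_le)
    fun _ => eLpNorm_mono_measure _ hμ

/-- The inequality on segments, integrated over a swept region, for `H¹` functions with a trace on
the base curve. -/
theorem IsSwept.mul_setIntegral_norm_sq_le {R Ω : Set (ℝ × ℝ)} {I : Set ℝ} {L : ℝ}
    {m : ℝ → ℝ} (h : IsSwept o e₁ e₂ R I L m) (hRΩ : R ⊆ Ω) {b : ℝ} (hb : 0 ≤ b)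
    (hbL : b * L < Real.pi / 2) {c : ℝ → ℝ × ℝ} (hc : ∀ r, frame o e₁ e₂ (r, 0) = c r)
    {F : Jet Ω} {g : L2line I} (hF : HasTrace Ω c I F g) :
    b ^ 2 * ∫ p in R, ‖F.1 p‖ ^ 2
      ≤ (∫ p in R, ‖(e₂.1 : ℂ) * F.2.1 p + (e₂.2 : ℂ) * F.2.2 p‖ ^ 2)
      + b * Real.tan (b * L) * ∫ r in I, ‖g r‖ ^ 2 := by
  obtain ⟨w, hw, t0, t1, t2, tg⟩ := hF
  have hle : (volume.restrict R : Measure (ℝ × ℝ)) ≤ volume.restrict Ω :=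
    Measure.restrict_mono hRΩ le_rfl
  have hm : ∀ n, ∀ e, MemLp (fun p => fderiv ℝ (w n) p e) 2 (volume.restrict R) := fun n e =>
    ((continuous_fderiv_apply (hw n).1 e).memLp_of_hasCompactSupport
      (hasCompactSupport_fderiv_apply (hw n).2 e)).restrict _
  set D : L2 Ω := (e₂.1 : ℂ) • F.2.1 + (e₂.2 : ℂ) • F.2.2 with hD
  have tD : Tendsto (fun n => eLpNorm (fun p => fderiv ℝ (w n) p e₂ - D p) 2
      (volume.restrict Ω)) atTop (𝓝 0) := by
    simp only [fderiv_apply_eq _ _ e₂]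
    exact tendsto_eLpNorm_add
      (fun n => ((continuous_fderiv_apply (hw n).1 _).const_mul _).aestronglyMeasurable)
      (fun n => ((continuous_fderiv_apply (hw n).1 _).const_mul _).aestronglyMeasurable)
      (tendsto_eLpNorm_smul _ t1) (tendsto_eLpNorm_smul _ t2)
  have hDeq : ∫ p in R, ‖(e₂.1 : ℂ) * F.2.1 p + (e₂.2 : ℂ) * F.2.2 p‖ ^ 2
      = ∫ p in R, ‖D p‖ ^ 2 := by
    refine integral_congr_ae (ae_mono hle ?_)
    filter_upwards [Lp.coeFn_add ((e₂.1 : ℂ) • F.2.1) ((e₂.2 : ℂ) • F.2.2),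
      Lp.coeFn_smul (e₂.1 : ℂ) F.2.1, Lp.coeFn_smul (e₂.2 : ℂ) F.2.2] with p h1 h2 h3
    rw [hD, h1, Pi.add_apply, h2, h3]
    simp
  have l0 := tendsto_integral_norm_sq_of_tendsto_eLpNorm
    (fun n => ((hw n).1.continuous.memLp_of_hasCompactSupport (hw n).2).restrict R)
    ((Lp.memLp F.1).mono_measure hle) (tendsto_eLpNorm_restrict hle t0)
  have l1 := tendsto_integral_norm_sq_of_tendsto_eLpNorm (fun n => hm n e₂)
    ((Lp.memLp D).mono_measure hle) (tendsto_eLpNorm_restrict hle tD)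
  have hfc : Continuous (frame o e₁ e₂) := contDiff_frame.continuous
  have lg := tendsto_integral_norm_sq_of_tendsto_eLpNorm
    (fun n => by
      have hcn := (hw n).1.continuous
      have := (Continuous.memLp_of_hasCompactSupport (μ := volume) (p := 2)
        (show Continuous fun r : ℝ => w n (frame o e₁ e₂ (r, 0)) by fun_prop)
        (hasCompactSupport_frame_line h.unimodular (hw n).2)).restrict I
      simpa only [hc] using this)
    (Lp.memLp g) tg
  rw [hDeq]
  refine le_of_tendsto_of_tendsto' (l0.const_mul (b ^ 2))
    (l1.add (lg.const_mul (b * Real.tan (b * L)))) fun n => ?_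
  have := h.mul_setIntegral_norm_sq_le_of_contDiff hb hbL (hw n).1 (hw n).2
  simpa only [hc] using this

end

/-! ### The lower bound of the form -/

/-- The part of the pencil with `y ≤ x` and `x + y ≤ d`. -/
def lowerTriangle (d : ℝ) : Set (ℝ × ℝ) := {p | 0 ≤ p.2 ∧ p.2 ≤ p.1 ∧ p.1 + p.2 ≤ d}

/-- The part of the pencil with `x ≤ y` and `x + y ≤ d`. -/
def upperTriangle (d : ℝ) : Set (ℝ × ℝ) := {p | 0 ≤ p.1 ∧ p.1 ≤ p.2 ∧ p.1 + p.2 ≤ d}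

/-- The part of the pencil with `y ≤ x` and `x + y ≥ d`. -/
def lowerStrip (d : ℝ) : Set (ℝ × ℝ) := {p | d ≤ p.1 + p.2 ∧ p.2 ≤ p.1 ∧ p.1 - p.2 ≤ d}

/-- The part of the pencil with `x ≤ y` and `x + y ≥ d`. -/
def upperStrip (d : ℝ) : Set (ℝ × ℝ) := {p | d ≤ p.1 + p.2 ∧ p.1 ≤ p.2 ∧ p.2 - p.1 ≤ d}

theorem measurableSet_le_and_le_and_le {f₁ g₁ f₂ g₂ f₃ g₃ : ℝ × ℝ → ℝ} (h₁ : Measurable f₁)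
    (k₁ : Measurable g₁) (h₂ : Measurable f₂) (k₂ : Measurable g₂) (h₃ : Measurable f₃)
    (k₃ : Measurable g₃) : MeasurableSet {p | f₁ p ≤ g₁ p ∧ f₂ p ≤ g₂ p ∧ f₃ p ≤ g₃ p} :=
  (measurableSet_le h₁ k₁).inter ((measurableSet_le h₂ k₂).inter (measurableSet_le h₃ k₃))

theorem measurableSet_lowerTriangle (d : ℝ) : MeasurableSet (lowerTriangle d) := by
  unfold lowerTriangle
  apply measurableSet_le_and_le_and_le <;> fun_prop

theorem measurableSet_upperTriangle (d : ℝ) : MeasurableSet (upperTriangle d) := by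
  unfold upperTriangle
  apply measurableSet_le_and_le_and_le <;> fun_prop

theorem measurableSet_lowerStrip (d : ℝ) : MeasurableSet (lowerStrip d) := by
  unfold lowerStrip
  apply measurableSet_le_and_le_and_le <;> fun_prop

theorem measurableSet_upperStrip (d : ℝ) : MeasurableSet (upperStrip d) := by
  unfold upperStrip
  apply measurableSet_le_and_le_and_le <;> fun_prop

theorem isSwept_lowerTriangle (d : ℝ) :
    IsSwept 0 (1, 0) (0, 1) (lowerTriangle d) (Set.Icc 0 d) (d / 2) (fun r => min r (d - r)) where
  unimodular := by norm_num [IsUnimodular]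
  measurableSet := measurableSet_lowerTriangle d
  measurableSet_base := measurableSet_Icc
  nonneg r hr := le_min hr.1 (sub_nonneg.mpr hr.2)
  le r _ := by
    have h1 := min_le_left r (d - r)
    have h2 := min_le_right r (d - r)
    linarith
  mem_iff r u := by
    simp only [frame, lowerTriangle, Set.mem_ofPred_eq, Set.mem_Icc, Prod.fst_add, Prod.snd_add,
      Prod.smul_fst, Prod.smul_snd, Prod.fst_zero, Prod.snd_zero, smul_eq_mul, le_min_iff]
    constructor
    · rintro ⟨h1, h2, h3⟩
      refine ⟨⟨?_, ?_⟩, ?_, ?_, ?_⟩ <;> linarith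
    · rintro ⟨⟨h1, h2⟩, h3, h4, h5⟩
      refine ⟨?_, ?_, ?_⟩ <;> linarith

theorem isSwept_upperTriangle (d : ℝ) :
    IsSwept 0 (0, 1) (1, 0) (upperTriangle d) (Set.Icc 0 d) (d / 2) (fun r => min r (d - r)) where
  unimodular := by norm_num [IsUnimodular]
  measurableSet := measurableSet_upperTriangle d
  measurableSet_base := measurableSet_Icc
  nonneg r hr := le_min hr.1 (sub_nonneg.mpr hr.2)
  le r _ := by
    have h1 := min_le_left r (d - r)
    have h2 := min_le_right r (d - r)
    linarith
  mem_iff r u := by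
    simp only [frame, upperTriangle, Set.mem_ofPred_eq, Set.mem_Icc, Prod.fst_add, Prod.snd_add,
      Prod.smul_fst, Prod.smul_snd, Prod.fst_zero, Prod.snd_zero, smul_eq_mul, le_min_iff]
    constructor
    · rintro ⟨h1, h2, h3⟩
      refine ⟨⟨?_, ?_⟩, ?_, ?_, ?_⟩ <;> linarith
    · rintro ⟨⟨h1, h2⟩, h3, h4, h5⟩
      refine ⟨?_, ?_, ?_⟩ <;> linarith

theorem isSwept_lowerStrip {d : ℝ} (hd : 0 < d) :
    IsSwept (d, 0) (1, 1) (-1 / 2, 1 / 2) (lowerStrip d) (Set.Ici 0) d (fun _ => d) where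
  unimodular := by norm_num [IsUnimodular]
  measurableSet := measurableSet_lowerStrip d
  measurableSet_base := measurableSet_Ici
  nonneg _ _ := hd.le
  le _ _ := le_rfl
  mem_iff r u := by
    simp only [frame, lowerStrip, Set.mem_ofPred_eq, Set.mem_Icc, Set.mem_Ici, Prod.fst_add,
      Prod.snd_add, Prod.smul_fst, Prod.smul_snd, smul_eq_mul]
    constructor
    · rintro ⟨h1, h2, h3⟩
      refine ⟨?_, ?_, ?_⟩ <;> linarith
    · rintro ⟨h1, h2, h3⟩
      refine ⟨?_, ?_, ?_⟩ <;> linarith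

theorem isSwept_upperStrip {d : ℝ} (hd : 0 < d) :
    IsSwept (0, d) (1, 1) (1 / 2, -1 / 2) (upperStrip d) (Set.Ici 0) d (fun _ => d) where
  unimodular := by norm_num [IsUnimodular]
  measurableSet := measurableSet_upperStrip d
  measurableSet_base := measurableSet_Ici
  nonneg _ _ := hd.le
  le _ _ := le_rfl
  mem_iff r u := by
    simp only [frame, upperStrip, Set.mem_ofPred_eq, Set.mem_Icc, Set.mem_Ici, Prod.fst_add,
      Prod.snd_add, Prod.smul_fst, Prod.smul_snd, smul_eq_mul]
    constructor
    · rintro ⟨h1, h2, h3⟩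
      refine ⟨?_, ?_, ?_⟩ <;> linarith
    · rintro ⟨h1, h2, h3⟩
      refine ⟨?_, ?_, ?_⟩ <;> linarith

theorem pencil_eq_union (d : ℝ) :
    pencil d = (lowerTriangle d ∪ upperTriangle d) ∪ (lowerStrip d ∪ upperStrip d) := by
  ext p
  simp only [pencil, lowerTriangle, upperTriangle, lowerStrip, upperStrip, Set.mem_union,
    Set.mem_ofPred_eq, abs_le]
  constructor
  · rintro ⟨h1, h2, h3, h4⟩
    rcases le_total p.1 p.2 with h | h <;> rcases le_total (p.1 + p.2) d with h' | h'
    · exact .inl (.inr ⟨h1, h, h'⟩)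
    · exact .inr (.inr ⟨h', h, by linarith⟩)
    · exact .inl (.inl ⟨h2, h, h'⟩)
    · exact .inr (.inl ⟨h', h, by linarith⟩)
  · rintro ((⟨h1, h2, h3⟩ | ⟨h1, h2, h3⟩) | (⟨h1, h2, h3⟩ | ⟨h1, h2, h3⟩)) <;>
      refine ⟨?_, ?_, ?_, ?_⟩ <;> linarith

theorem volume_graph_eq_zero {f : ℝ → ℝ} (hf : Measurable f) :
    volume {p : ℝ × ℝ | p.2 = f p.1} = 0 := by
  have hm : MeasurableSet {p : ℝ × ℝ | p.2 = f p.1} :=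
    measurableSet_eq_fun measurable_snd (hf.comp measurable_fst)
  rw [Measure.volume_eq_prod, Measure.measure_prod_null hm]
  refine Eventually.of_forall fun x => ?_
  simp only [Set.preimage, Set.mem_ofPred_eq]
  exact (Set.subsingleton_singleton (a := f x)).anti (fun y hy => hy) |>.measure_zero volume

/-- The four pieces overlap only along the lines `x = y` and `x + y = d`. -/
theorem restrict_pencil (d : ℝ) : (volume.restrict (pencil d) : Measure (ℝ × ℝ))
    = (volume.restrict (lowerTriangle d) + volume.restrict (upperTriangle d))
      + (volume.restrict (lowerStrip d) + volume.restrict (upperStrip d)) := by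
  have h1 : AEDisjoint volume (lowerTriangle d) (upperTriangle d) :=
    measure_mono_null (fun p hp => show p.2 = id p.1 from le_antisymm hp.1.2.1 hp.2.2.1)
      (volume_graph_eq_zero measurable_id)
  have h2 : AEDisjoint volume (lowerStrip d) (upperStrip d) :=
    measure_mono_null (fun p hp => show p.2 = id p.1 from le_antisymm hp.1.2.1 hp.2.2.1)
      (volume_graph_eq_zero measurable_id)
  have h3 : AEDisjoint volume (lowerTriangle d ∪ upperTriangle d)
      (lowerStrip d ∪ upperStrip d) := by
    refine measure_mono_null (fun p hp => ?_)
      (volume_graph_eq_zero (f := fun x => d - x) (by fun_prop))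
    have a1 : p.1 + p.2 ≤ d := hp.1.elim (fun h => h.2.2) (fun h => h.2.2)
    have a2 : d ≤ p.1 + p.2 := hp.2.elim (fun h => h.1) (fun h => h.1)
    exact show p.2 = d - p.1 by linarith
  have m1 := (measurableSet_upperTriangle d).nullMeasurableSet (μ := volume)
  have m2 := (measurableSet_upperStrip d).nullMeasurableSet (μ := volume)
  have m3 := ((measurableSet_lowerStrip d).union (measurableSet_upperStrip d)).nullMeasurableSet
    (μ := volume)
  rw [pencil_eq_union, Measure.restrict_union₀ h3 m3, Measure.restrict_union₀ h1 m1,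
    Measure.restrict_union₀ h2 m2]

theorem setIntegral_pencil {E : Type*} [NormedAddCommGroup E] [NormedSpace ℝ E] {d : ℝ}
    {f : ℝ × ℝ → E} (hf : IntegrableOn f (pencil d)) :
    ∫ p in pencil d, f p = ((∫ p in lowerTriangle d, f p) + ∫ p in upperTriangle d, f p)
      + ((∫ p in lowerStrip d, f p) + ∫ p in upperStrip d, f p) := by
  unfold IntegrableOn at hf
  rw [restrict_pencil] at hf ⊢
  have h1 := hf.left_of_add_measure
  have h2 := hf.right_of_add_measure
  rw [integral_add_measure h1 h2,
    integral_add_measure h1.left_of_add_measure h1.right_of_add_measure,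
    integral_add_measure h2.left_of_add_measure h2.right_of_add_measure]

/-- The bottom of the essential spectrum: the lowest Dirichlet eigenvalue
of the cross-section, of width `√2 d`, of the strip. -/
def threshold (d : ℝ) : ℝ := 2 * (Real.pi / (2 * d)) ^ 2

/-- The strength of the boundary repulsion that suffices to keep the form above the threshold. -/
def couplingBound (d : ℝ) : ℝ :=
  √2 * (Real.pi / (2 * d)) * Real.tan (√2 * (Real.pi / (2 * d)) * (d / 2))

theorem sqrt_two_mul_lt {d : ℝ} (hd : 0 < d) :
    √2 * (Real.pi / (2 * d)) * (d / 2) < Real.pi / 2 := by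
  have h : √2 * (Real.pi / (2 * d)) * (d / 2) = √2 * (Real.pi / 4) := by
    field_simp
    ring
  have : √2 < 2 := by
    rw [Real.sqrt_lt' (by norm_num)]
    norm_num
  rw [h]
  nlinarith [Real.pi_pos]

theorem couplingBound_pos {d : ℝ} (hd : 0 < d) : 0 < couplingBound d := by
  have := Real.pi_pos
  exact mul_pos (by positivity)
    (Real.tan_pos_of_pos_of_lt_pi_div_two (by positivity) (sqrt_two_mul_lt hd))

theorem integrable_norm_sq {X : Type*} [MeasurableSpace X] {μ : Measure X} (u : Lp ℂ 2 μ) :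
    Integrable (fun p => ‖u p‖ ^ 2) μ :=
  (Lp.memLp u).integrable_norm_pow (by norm_num)

theorem integrable_gradient {Ω : Set (ℝ × ℝ)} (F : Jet Ω) :
    IntegrableOn (fun p => ‖F.2.1 p‖ ^ 2 + ‖F.2.2 p‖ ^ 2) Ω :=
  (integrable_norm_sq _).add (integrable_norm_sq _)

theorem norm_mul_add_mul_sq_le (a b : ℝ) (z w : ℂ) :
    ‖(a : ℂ) * z + (b : ℂ) * w‖ ^ 2 ≤ (a ^ 2 + b ^ 2) * (‖z‖ ^ 2 + ‖w‖ ^ 2) := by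
  have h : ‖(a : ℂ) * z + (b : ℂ) * w‖ ≤ |a| * ‖z‖ + |b| * ‖w‖ := by
    refine (norm_add_le _ _).trans_eq ?_
    simp
  have h2 := pow_le_pow_left₀ (norm_nonneg _) h 2
  nlinarith [sq_nonneg (|a| * ‖w‖ - |b| * ‖z‖), sq_abs a, sq_abs b]

theorem setIntegral_norm_sq_directional_le {Ω R : Set (ℝ × ℝ)} (hR : R ⊆ Ω) (F : Jet Ω)
    (e : ℝ × ℝ) : ∫ p in R, ‖(e.1 : ℂ) * F.2.1 p + (e.2 : ℂ) * F.2.2 p‖ ^ 2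
      ≤ (e.1 ^ 2 + e.2 ^ 2) * ∫ p in R, (‖F.2.1 p‖ ^ 2 + ‖F.2.2 p‖ ^ 2) := by
  rw [← integral_const_mul]
  exact integral_mono_of_nonneg (Eventually.of_forall fun p => by positivity)
    (((integrable_gradient F).mono_set hR).const_mul _)
    (Eventually.of_forall fun p => norm_mul_add_mul_sq_le _ _ _ _)

/-- In a triangle the length of the segments is at most `d / 2`, which leaves room for
`b² = threshold d` with a finite boundary term. -/
theorem threshold_mul_le_of_isSwept_triangle {d : ℝ} (hd : 0 < d) {o e₁ e₂ : ℝ × ℝ}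
    {R : Set (ℝ × ℝ)} {m : ℝ → ℝ} (h : IsSwept o e₁ e₂ R (Set.Icc 0 d) (d / 2) m)
    (hR : R ⊆ pencil d) (he : e₂.1 ^ 2 + e₂.2 ^ 2 = 1) {c : ℝ → ℝ × ℝ}
    (hc : ∀ r, frame o e₁ e₂ (r, 0) = c r) {F : Jet (pencil d)} {g : L2line (Set.Icc 0 d)}
    (hF : HasTrace (pencil d) c (Set.Icc 0 d) F g) :
    threshold d * ∫ p in R, ‖F.1 p‖ ^ 2 ≤ (∫ p in R, (‖F.2.1 p‖ ^ 2 + ‖F.2.2 p‖ ^ 2))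
        + couplingBound d * ∫ r in Set.Icc 0 d, ‖g r‖ ^ 2 := by
  have h1 := h.mul_setIntegral_norm_sq_le hR (b := √2 * (Real.pi / (2 * d)))
    (by have := Real.pi_pos; positivity) (sqrt_two_mul_lt hd) hc hF
  have h2 := setIntegral_norm_sq_directional_le hR F e₂
  rw [he, one_mul] at h2
  rw [mul_pow, Real.sq_sqrt (by norm_num)] at h1
  unfold threshold couplingBound
  linarith

/-- In a half-strip the trace on the side vanishes, and the derivative along the axis `e₂`,
of length `1 / √2`, is bounded by the gradient with the factor `1 / 2` on squares. -/
theorem threshold_mul_le_of_isSwept_strip {d : ℝ} (hd : 0 < d) {o e₁ e₂ : ℝ × ℝ}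
    {R : Set (ℝ × ℝ)} {m : ℝ → ℝ} (h : IsSwept o e₁ e₂ R (Set.Ici 0) d m)
    (hR : R ⊆ pencil d) (he : e₂.1 ^ 2 + e₂.2 ^ 2 = 1 / 2) {c : ℝ → ℝ × ℝ}
    (hc : ∀ r, frame o e₁ e₂ (r, 0) = c r) {F : Jet (pencil d)}
    (hF : HasTrace (pencil d) c (Set.Ici 0) F 0) :
    threshold d * ∫ p in R, ‖F.1 p‖ ^ 2 ≤ ∫ p in R, (‖F.2.1 p‖ ^ 2 + ‖F.2.2 p‖ ^ 2) := by
  have hpi := Real.pi_pos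
  have h2 := setIntegral_norm_sq_directional_le hR F e₂
  rw [he] at h2
  have hz : ∫ r in Set.Ici (0 : ℝ), ‖(0 : L2line (Set.Ici 0)) r‖ ^ 2 = 0 := by
    refine integral_eq_zero_of_ae ?_
    filter_upwards [Lp.coeFn_zero ℂ 2 (volume.restrict (Set.Ici (0 : ℝ)))] with r hr
    rw [hr]
    simp
  -- the tangent is infinite at `b d = π / 2`, so this value is approached from below
  have hlim : Tendsto (fun b : ℝ => 2 * b ^ 2 * ∫ p in R, ‖F.1 p‖ ^ 2)
      (𝓝[<] (Real.pi / (2 * d))) (𝓝 (threshold d * ∫ p in R, ‖F.1 p‖ ^ 2)) :=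
    (Continuous.tendsto (by fun_prop) _).mono_left nhdsWithin_le_nhds
  refine le_of_tendsto hlim ?_
  have h0 : 0 < Real.pi / (2 * d) := by positivity
  filter_upwards [Ioo_mem_nhdsLT h0] with b hb
  have hbd : b * d < Real.pi / 2 := by
    have := mul_lt_mul_of_pos_right hb.2 hd
    have e : Real.pi / (2 * d) * d = Real.pi / 2 := by field_simp
    linarith
  have h1 := h.mul_setIntegral_norm_sq_le hR hb.1.le hbd hc hF
  rw [hz, mul_zero, add_zero] at h1
  linarith

theorem lowerTriangle_subset (d : ℝ) : lowerTriangle d ⊆ pencil d := by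
  rw [pencil_eq_union]
  exact fun p hp => .inl (.inl hp)

theorem upperTriangle_subset (d : ℝ) : upperTriangle d ⊆ pencil d := by
  rw [pencil_eq_union]
  exact fun p hp => .inl (.inr hp)

theorem lowerStrip_subset (d : ℝ) : lowerStrip d ⊆ pencil d := by
  rw [pencil_eq_union]
  exact fun p hp => .inr (.inl hp)

theorem upperStrip_subset (d : ℝ) : upperStrip d ⊆ pencil d := by
  rw [pencil_eq_union]
  exact fun p hp => .inr (.inr hp)

theorem frame_lowerStrip_zero (d r : ℝ) :
    frame (d, 0) (1, 1) (-1 / 2, 1 / 2) (r, 0) = (r + d, r) := by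
  ext <;> simp [frame, add_comm]

theorem frame_upperStrip_zero (d r : ℝ) :
    frame (0, d) (1, 1) (1 / 2, -1 / 2) (r, 0) = (r, r + d) := by
  ext <;> simp [frame, add_comm]

theorem threshold_mul_integral_norm_sq_le {d : ℝ} (hd : 0 < d) {F : FormData d}
    (hF : InFormDomain d F) :
    threshold d * ∫ p in pencil d, ‖F.1.1 p‖ ^ 2
      ≤ (∫ p in pencil d, (‖F.1.2.1 p‖ ^ 2 + ‖F.1.2.2 p‖ ^ 2))
        + couplingBound d * ((∫ r in Set.Icc 0 d, ‖F.2.1 r‖ ^ 2)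
          + ∫ r in Set.Icc 0 d, ‖F.2.2.1 r‖ ^ 2) := by
  obtain ⟨-, hl, hu, h1, h2, -⟩ := hF
  have a1 := threshold_mul_le_of_isSwept_triangle hd (isSwept_lowerTriangle d)
    (lowerTriangle_subset d) (by norm_num) (fun r => by ext <;> simp [frame]) h1
  have a2 := threshold_mul_le_of_isSwept_triangle hd (isSwept_upperTriangle d)
    (upperTriangle_subset d) (by norm_num) (fun r => by ext <;> simp [frame]) h2
  have a3 := threshold_mul_le_of_isSwept_strip hd (isSwept_lowerStrip hd)
    (lowerStrip_subset d) (by norm_num) (frame_lowerStrip_zero d) hl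
  have a4 := threshold_mul_le_of_isSwept_strip hd (isSwept_upperStrip hd)
    (upperStrip_subset d) (by norm_num) (frame_upperStrip_zero d) hu
  rw [setIntegral_pencil (integrable_norm_sq F.1.1), setIntegral_pencil (integrable_gradient F.1)]
  linarith

theorem integrable_potential_mul_norm_sq (σ : Potential) {I : Set ℝ} (hI : I ⊆ Set.Ici 0)
    (a : L2line I) : Integrable (fun y => σ y * ‖a y‖ ^ 2) (volume.restrict I) := by
  refine (integrable_potential_mul_inner σ hI a a).re.congr (Eventually.of_forall fun y => ?_)
  simp [inner_self_eq_norm_sq_to_K, ← Complex.ofReal_pow, ← Complex.ofReal_mul]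

theorem form_self (d : ℝ) (σ α : Potential) (F : FormData d) :
    form d σ α F F = (((∫ p in pencil d, (‖F.1.2.1 p‖ ^ 2 + ‖F.1.2.2 p‖ ^ 2))
      - (∫ y in Set.Icc 0 d, (σ y * ‖F.2.1 y‖ ^ 2 + σ y * ‖F.2.2.1 y‖ ^ 2))
      + ∫ y in Set.Ici 0, α y * ‖F.2.2.2 y‖ ^ 2 : ℝ) : ℂ) := by
  unfold form
  push_cast
  simp only [← integral_complex_ofReal, inner_self_eq_norm_sq_to_K]
  push_cast
  simp only [mul_add]
  rfl

/-- The form, less the contribution of the interaction on the diagonal, lies above the threshold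
when the boundary repulsion is strong. -/
theorem threshold_mul_add_le_form_self {d : ℝ} (hd : 0 < d) {σ α : Potential}
    (hσ : ∀ᵐ y ∂(volume.restrict (Set.Icc 0 d)), σ y ≤ -couplingBound d) {F : FormData d}
    (hF : InFormDomain d F) :
    threshold d * ‖F.1.1‖ ^ 2 + ∫ y in Set.Ici 0, α y * ‖F.2.2.2 y‖ ^ 2
      ≤ (form d σ α F F).re := by
  have hI : Set.Icc (0 : ℝ) d ⊆ Set.Ici 0 := fun y hy => hy.1
  have h1 := threshold_mul_integral_norm_sq_le hd hF
  rw [integral_norm_sq_eq_norm_toLp (Lp.memLp F.1.1), Lp.toLp_coeFn] at h1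
  have h2 : ∫ y in Set.Icc 0 d, (σ y * ‖F.2.1 y‖ ^ 2 + σ y * ‖F.2.2.1 y‖ ^ 2)
      ≤ ∫ y in Set.Icc 0 d, (-couplingBound d * (‖F.2.1 y‖ ^ 2 + ‖F.2.2.1 y‖ ^ 2)) := by
    refine integral_mono_ae ((integrable_potential_mul_norm_sq σ hI _).add
      (integrable_potential_mul_norm_sq σ hI _))
      (((integrable_norm_sq _).add (integrable_norm_sq _)).const_mul _) ?_
    filter_upwards [hσ] with y hy
    rw [← mul_add]
    exact mul_le_mul_of_nonneg_right hy (by positivity)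
  rw [integral_const_mul, integral_add (integrable_norm_sq _) (integrable_norm_sq _)] at h2
  rw [form_self, Complex.ofReal_re]
  linarith

/-! ### Test functions in `H¹` and quasi-modes on the line -/

theorem memLp_fderiv_apply {ζ : ℝ × ℝ → ℂ} (h1 : ContDiff ℝ ∞ ζ) (h2 : HasCompactSupport ζ)
    (Ω : Set (ℝ × ℝ)) (e : ℝ × ℝ) :
    MemLp (fun p => fderiv ℝ ζ p e) 2 (volume.restrict Ω) :=
  ((continuous_fderiv_apply h1 e).memLp_of_hasCompactSupport
    (hasCompactSupport_fderiv_apply h2 e)).restrict _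

theorem memLp_of_contDiff {ζ : ℝ × ℝ → ℂ} (h1 : ContDiff ℝ ∞ ζ) (h2 : HasCompactSupport ζ)
    (Ω : Set (ℝ × ℝ)) : MemLp ζ 2 (volume.restrict Ω) :=
  (h1.continuous.memLp_of_hasCompactSupport h2).restrict _

/-- The restriction to `Ω` of a test function on the plane, listed with its gradient. -/
def smoothJet (Ω : Set (ℝ × ℝ)) {ζ : ℝ × ℝ → ℂ} (h1 : ContDiff ℝ ∞ ζ)
    (h2 : HasCompactSupport ζ) : Jet Ω :=
  ((memLp_of_contDiff h1 h2 Ω).toLp ζ, (memLp_fderiv_apply h1 h2 Ω (1, 0)).toLp _,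
    (memLp_fderiv_apply h1 h2 Ω (0, 1)).toLp _)

theorem isWeakDeriv_toLp {Ω : Set (ℝ × ℝ)} {ζ : ℝ × ℝ → ℂ} (h1 : ContDiff ℝ ∞ ζ)
    (h2 : HasCompactSupport ζ) (e : ℝ × ℝ) : IsWeakDeriv Ω e
      ((memLp_of_contDiff h1 h2 Ω).toLp ζ) ((memLp_fderiv_apply h1 h2 Ω e).toLp _) := by
  intro θ t1 t2 t3
  have td : Continuous fun p => fderiv ℝ θ p e :=
    (t1.continuous_fderiv (by simp)).clm_apply continuous_const
  have tds : HasCompactSupport fun p => fderiv ℝ θ p e :=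
    (t2.fderiv (𝕜 := ℝ)).comp_left (g := fun L : ℝ × ℝ →L[ℝ] ℝ => L e) (by simp)
  have hz : ∀ p, p ∉ Ω → θ p = 0 := fun p hp =>
    image_eq_zero_of_notMem_tsupport fun h => hp (interior_subset (t3 h))
  have hzd : ∀ p, p ∉ Ω → fderiv ℝ θ p e = 0 := fun p hp => by
    have : p ∉ tsupport (fderiv ℝ θ) := fun h =>
      hp (interior_subset (t3 (tsupport_fderiv_subset ℝ h)))
    rw [image_eq_zero_of_notMem_tsupport this]
    rfl
  have a1 : (∫ p in Ω, fderiv ℝ θ p e • ((memLp_of_contDiff h1 h2 Ω).toLp ζ) p)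
      = ∫ p, fderiv ℝ θ p e • ζ p := by
    rw [← setIntegral_eq_integral_of_forall_compl_eq_zero (s := Ω)
      (f := fun p => fderiv ℝ θ p e • ζ p) (fun p hp => by simp only [hzd p hp, zero_smul])]
    refine integral_congr_ae ?_
    filter_upwards [(memLp_of_contDiff h1 h2 Ω).coeFn_toLp] with p hp
    rw [hp]
  have a2 : (∫ p in Ω, θ p • ((memLp_fderiv_apply h1 h2 Ω e).toLp _) p)
      = ∫ p, θ p • fderiv ℝ ζ p e := by
    rw [← setIntegral_eq_integral_of_forall_compl_eq_zero (s := Ω)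
      (f := fun p => θ p • fderiv ℝ ζ p e) (fun p hp => by simp only [hz p hp, zero_smul])]
    refine integral_congr_ae ?_
    filter_upwards [(memLp_fderiv_apply h1 h2 Ω e).coeFn_toLp] with p hp
    rw [hp]
  rw [a1, a2, eq_comm, neg_eq_iff_eq_neg]
  refine integral_smul_fderiv_eq_neg_fderiv_smul_of_integrable ?_ ?_ ?_
    (fun x _ => t1.differentiable (by simp) x) (fun x _ => h1.differentiable (by simp) x)
  · exact (td.smul h1.continuous).integrable_of_hasCompactSupport tds.smul_right
  · exact (t1.continuous.smul (continuous_fderiv_apply h1 e)).integrable_of_hasCompactSupport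
      t2.smul_right
  · exact (t1.continuous.smul h1.continuous).integrable_of_hasCompactSupport t2.smul_right

theorem isH1_smoothJet (Ω : Set (ℝ × ℝ)) {ζ : ℝ × ℝ → ℂ} (h1 : ContDiff ℝ ∞ ζ)
    (h2 : HasCompactSupport ζ) : IsH1 Ω (smoothJet Ω h1 h2) :=
  ⟨isWeakDeriv_toLp h1 h2 _, isWeakDeriv_toLp h1 h2 _⟩

theorem hasTrace_smoothJet (Ω : Set (ℝ × ℝ)) {ζ : ℝ × ℝ → ℂ} (h1 : ContDiff ℝ ∞ ζ)
    (h2 : HasCompactSupport ζ) (c : ℝ → ℝ × ℝ) (I : Set ℝ) (g : L2line I)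
    (hg : g =ᵐ[volume.restrict I] fun t => ζ (c t)) : HasTrace Ω c I (smoothJet Ω h1 h2) g := by
  have zero_of : ∀ {X : Type} [MeasurableSpace X] (μ : Measure X) (f g : X → ℂ),
      f =ᵐ[μ] g → Tendsto (fun _ : ℕ => eLpNorm (fun p => f p - g p) 2 μ) atTop (𝓝 0) :=
    fun μ f g hfg => by
      have : eLpNorm (fun p => f p - g p) 2 μ = 0 := by
        rw [← eLpNorm_zero (p := 2) (μ := μ) (ε := ℂ)]
        refine eLpNorm_congr_ae ?_
        filter_upwards [hfg] with p hp
        rw [hp, sub_self]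
        rfl
      rw [this]
      exact tendsto_const_nhds
  exact ⟨fun _ => ζ, fun _ => ⟨h1, h2⟩,
    zero_of _ _ _ (memLp_of_contDiff h1 h2 Ω).coeFn_toLp.symm,
    zero_of _ _ _ (memLp_fderiv_apply h1 h2 Ω (1, 0)).coeFn_toLp.symm,
    zero_of _ _ _ (memLp_fderiv_apply h1 h2 Ω (0, 1)).coeFn_toLp.symm, zero_of _ _ _ hg.symm⟩

/-- The plane wave `exp (i k c)` with the amplitude `ρ (c / n)`. -/
def modulatedWave (ρ : ℝ → ℝ) (k n c : ℝ) : ℂ := ρ (c / n) * Complex.exp ((k * c : ℝ) * Complex.I)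

theorem norm_sq_modulatedWave (ρ : ℝ → ℝ) (k n c : ℝ) :
    ‖modulatedWave ρ k n c‖ ^ 2 = ρ (c / n) ^ 2 := by
  rw [modulatedWave, norm_mul, Complex.norm_exp_ofReal_mul_I, mul_one, Complex.norm_real,
    Real.norm_eq_abs, sq_abs]

theorem contDiff_modulatedWave {ρ : ℝ → ℝ} (hρ : ContDiff ℝ ∞ ρ) (k n : ℝ) :
    ContDiff ℝ ∞ (modulatedWave ρ k n) := by
  have h1 : ContDiff ℝ ∞ fun c : ℝ => (ρ (c / n) : ℂ) :=
    Complex.ofRealCLM.contDiff.comp (hρ.comp (contDiff_id.div_const n))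
  have h2 : ContDiff ℝ ∞ fun c : ℝ => Complex.exp ((k * c : ℝ) * Complex.I) := by
    refine ContDiff.cexp (ContDiff.mul ?_ contDiff_const)
    exact Complex.ofRealCLM.contDiff.comp (contDiff_const.mul contDiff_id)
  exact h1.mul h2

theorem hasDerivAt_modulatedWave {ρ : ℝ → ℝ} (hρ : Differentiable ℝ ρ) (k n c : ℝ) :
    HasDerivAt (modulatedWave ρ k n)
      ((n : ℂ)⁻¹ * modulatedWave (deriv ρ) k n c + k * Complex.I * modulatedWave ρ k n c) c := by
  have h0 : HasDerivAt (fun c : ℝ => ((k * c : ℝ) : ℂ) * Complex.I) (k * Complex.I) c := by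
    have := (((hasDerivAt_id c).const_mul k).ofReal_comp).mul_const Complex.I
    simpa using this
  have h1 : HasDerivAt (fun c => c / n) (1 / n) c := (hasDerivAt_id c).div_const n
  have h2 := ((hρ (c / n)).hasDerivAt.comp c h1).ofReal_comp
  refine (h2.mul h0.cexp).congr_deriv ?_
  simp only [modulatedWave, Function.comp_apply]
  push_cast
  ring

theorem norm_sq_deriv_deriv_modulatedWave_add {ρ : ℝ → ℝ} (hρ : ContDiff ℝ ∞ ρ) (k n c : ℝ) :
    ‖deriv (deriv (modulatedWave ρ k n)) c + k ^ 2 * modulatedWave ρ k n c‖ ^ 2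
      = n⁻¹ ^ 4 * deriv (deriv ρ) (c / n) ^ 2 + 4 * k ^ 2 * n⁻¹ ^ 2 * deriv ρ (c / n) ^ 2 := by
  have hρ1 : ContDiff ℝ ∞ (deriv ρ) := hρ.deriv'
  have d0 : Differentiable ℝ ρ := hρ.differentiable (by simp)
  have d1 : Differentiable ℝ (deriv ρ) := hρ1.differentiable (by simp)
  have e1 : deriv (modulatedWave ρ k n) = fun c =>
      (n : ℂ)⁻¹ * modulatedWave (deriv ρ) k n c + k * Complex.I * modulatedWave ρ k n c :=
    funext fun c => (hasDerivAt_modulatedWave d0 k n c).deriv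
  have e2 := (((hasDerivAt_modulatedWave d1 k n c).const_mul (n : ℂ)⁻¹).add
    ((hasDerivAt_modulatedWave d0 k n c).const_mul (k * Complex.I))).deriv
  have e3 : deriv (deriv (modulatedWave ρ k n)) c + k ^ 2 * modulatedWave ρ k n c
      = ((n⁻¹ ^ 2 * deriv (deriv ρ) (c / n) : ℝ)
          + (2 * k * n⁻¹ * deriv ρ (c / n) : ℝ) * Complex.I)
        * Complex.exp ((k * c : ℝ) * Complex.I) := by
    rw [e1]
    refine (congrArg (· + _) e2).trans ?_
    simp only [modulatedWave]
    push_cast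
    linear_combination (k ^ 2 * ρ (c / n) * Complex.exp (k * c * Complex.I) : ℂ) * Complex.I_sq
  rw [e3, norm_mul, Complex.norm_exp_ofReal_mul_I, mul_one, Complex.sq_norm,
    Complex.normSq_add_mul_I]
  ring

theorem exists_contDiff_amplitude : ∃ ρ : ℝ → ℝ, ContDiff ℝ ∞ ρ ∧ HasCompactSupport ρ ∧
    Function.support ρ ⊆ Set.Ioo 1 3 ∧ ρ 2 = 1 := by
  let ρ : ContDiffBump (2 : ℝ) := ⟨1 / 2, 1, by norm_num, by norm_num⟩
  refine ⟨ρ, ρ.contDiff, ρ.hasCompactSupport, ?_, ρ.one_of_mem_closedBall (by simp [ρ])⟩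
  rw [ρ.support_eq, Real.ball_eq_Ioo]
  norm_num [ρ]

/-- Slowly modulated plane waves far out on the line solve `f'' + k² f = 0` up to an error that is
small in `L²`. -/
theorem exists_quasimode_line (k N : ℝ) {δ : ℝ} (hδ : 0 < δ) :
    ∃ (f : ℝ → ℂ) (T : ℝ), ContDiff ℝ ∞ f ∧ tsupport f ⊆ Set.Ioo N T ∧ 0 < ∫ c, ‖f c‖ ^ 2 ∧
      ∫ c, ‖deriv (deriv f) c + k ^ 2 * f c‖ ^ 2 ≤ δ * ∫ c, ‖f c‖ ^ 2 := by
  obtain ⟨ρ, hsm, hcs, hsupp, hρ2⟩ := exists_contDiff_amplitude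
  have hsm1 : ContDiff ℝ ∞ (deriv ρ) := hsm.deriv'
  have hsm2 : ContDiff ℝ ∞ (deriv (deriv ρ)) := hsm1.deriv'
  have hsq : ∀ {g : ℝ → ℝ}, HasCompactSupport g → HasCompactSupport fun x => g x ^ 2 := fun h =>
    h.comp_left (g := fun x => x ^ 2) (by simp)
  have i1 : Integrable fun x => deriv ρ x ^ 2 :=
    (hsm1.continuous.pow 2).integrable_of_hasCompactSupport (hsq hcs.deriv)
  have i2 : Integrable fun x => deriv (deriv ρ) x ^ 2 :=
    (hsm2.continuous.pow 2).integrable_of_hasCompactSupport (hsq hcs.deriv.deriv)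
  have hApos : 0 < ∫ x, ρ x ^ 2 :=
    (hsm.continuous.pow 2).integral_pos_of_hasCompactSupport_nonneg_nonzero
      (hsq hcs) (fun x => sq_nonneg _) (x := 2) (by simp [hρ2])
  have hB0 : 0 ≤ ∫ x, deriv ρ x ^ 2 := integral_nonneg fun x => sq_nonneg _
  have hC0 : 0 ≤ ∫ x, deriv (deriv ρ) x ^ 2 := integral_nonneg fun x => sq_nonneg _
  have hI0 : ∀ n : ℝ, 0 < n → ∫ c, ‖modulatedWave ρ k n c‖ ^ 2 = n * ∫ x, ρ x ^ 2 := by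
    intro n hn
    simp only [norm_sq_modulatedWave]
    rw [Measure.integral_comp_div (fun x => ρ x ^ 2) n, abs_of_pos hn, smul_eq_mul]
  have hI2 : ∀ n : ℝ, 0 < n →
      ∫ c, ‖deriv (deriv (modulatedWave ρ k n)) c + k ^ 2 * modulatedWave ρ k n c‖ ^ 2
      = n⁻¹ ^ 4 * (n * ∫ x, deriv (deriv ρ) x ^ 2)
        + 4 * k ^ 2 * n⁻¹ ^ 2 * (n * ∫ x, deriv ρ x ^ 2) := by
    intro n hn
    simp only [norm_sq_deriv_deriv_modulatedWave_add hsm]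
    rw [integral_add ((i2.comp_div hn.ne').const_mul _) ((i1.comp_div hn.ne').const_mul _),
      integral_const_mul, integral_const_mul,
      Measure.integral_comp_div (fun x => deriv (deriv ρ) x ^ 2) n,
      Measure.integral_comp_div (fun x => deriv ρ x ^ 2) n, abs_of_pos hn, smul_eq_mul,
      smul_eq_mul]
  generalize ∫ x, ρ x ^ 2 = A at *
  generalize ∫ x, deriv ρ x ^ 2 = B at *
  generalize ∫ x, deriv (deriv ρ) x ^ 2 = C at *
  -- `∫ |f|² = n A`, while the error is at most `C + 4 k² B` uniformly in `n ≥ 1`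
  obtain ⟨n, hn1, hnN, hnδ⟩ : ∃ n : ℝ, 1 ≤ n ∧ N < n ∧ C + 4 * k ^ 2 * B ≤ δ * A * n := by
    refine ⟨max 1 (max (N + 1) ((C + 4 * k ^ 2 * B) / (δ * A))), le_max_left _ _, ?_, ?_⟩
    · exact (lt_add_one N).trans_le ((le_max_left _ _).trans (le_max_right _ _))
    · rw [← div_le_iff₀' (by positivity)]
      exact (le_max_right _ _).trans (le_max_right _ _)
  have hn0 : 0 < n := by linarith
  refine ⟨modulatedWave ρ k n, 3 * n + 1, contDiff_modulatedWave hsm k n, ?_, ?_, ?_⟩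
  · have hsub : tsupport (modulatedWave ρ k n) ⊆ Set.Icc n (3 * n) := by
      refine closure_minimal (fun c hc => ?_) isClosed_Icc
      have h1 : c / n ∈ Set.Ioo (1 : ℝ) 3 := hsupp fun h => hc (by simp [modulatedWave, h])
      have h2 : c / n * n = c := div_mul_cancel₀ c hn0.ne'
      constructor <;> nlinarith [h1.1, h1.2]
    exact fun c hc => ⟨by linarith [(hsub hc).1], by linarith [(hsub hc).2]⟩
  · rw [hI0 n hn0]
    positivity
  · rw [hI0 n hn0, hI2 n hn0]
    have hi0 : 0 < n⁻¹ := inv_pos.mpr hn0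
    have hi1 : n⁻¹ ≤ 1 := inv_le_one_of_one_le₀ hn1
    have e1 : n⁻¹ ^ 4 * (n * C) = n⁻¹ ^ 3 * C := by field_simp
    have e2 : 4 * k ^ 2 * n⁻¹ ^ 2 * (n * B) = n⁻¹ * (4 * k ^ 2 * B) := by field_simp
    rw [e1, e2]
    have h1 : n⁻¹ ^ 3 * C ≤ C := mul_le_of_le_one_left hC0 (pow_le_one₀ hi0.le hi1)
    have h2 : n⁻¹ * (4 * k ^ 2 * B) ≤ 4 * k ^ 2 * B :=
      mul_le_of_le_one_left (by positivity) hi1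
    linarith

/-! ### Green's identity on a rectangle -/

theorem fderiv_apply_one_zero_eq_of_hasDerivAt {F : ℝ × ℝ → ℂ} (hF : Differentiable ℝ F)
    {q : ℝ × ℝ} {z : ℂ} (h : HasDerivAt (fun r => F (r, q.2)) z q.1) :
    fderiv ℝ F q (1, 0) = z := by
  have h1 : HasDerivAt (fun r : ℝ => (r, q.2)) ((1 : ℝ), (0 : ℝ)) q.1 :=
    (hasDerivAt_id q.1).prodMk (hasDerivAt_const _ _)
  exact (HasFDerivAt.comp_hasDerivAt q.1 (hF q).hasFDerivAt h1).unique h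

theorem fderiv_apply_zero_one_eq_of_hasDerivAt {F : ℝ × ℝ → ℂ} (hF : Differentiable ℝ F)
    {q : ℝ × ℝ} {z : ℂ} (h : HasDerivAt (fun u => F (q.1, u)) z q.2) :
    fderiv ℝ F q (0, 1) = z := by
  have h1 : HasDerivAt (fun u : ℝ => (q.1, u)) ((0 : ℝ), (1 : ℝ)) q.2 :=
    (hasDerivAt_const _ _).prodMk (hasDerivAt_id q.2)
  exact (HasFDerivAt.comp_hasDerivAt q.2 (hF q).hasFDerivAt h1).unique h

theorem hasDerivAt_line_fst {F : ℝ × ℝ → ℂ} (hF : Differentiable ℝ F) (q : ℝ × ℝ) :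
    HasDerivAt (fun r => F (r, q.2)) (fderiv ℝ F q (1, 0)) q.1 :=
  HasFDerivAt.comp_hasDerivAt q.1 (hF q).hasFDerivAt
    ((hasDerivAt_id q.1).prodMk (hasDerivAt_const _ _))

theorem hasDerivAt_line_snd {F : ℝ × ℝ → ℂ} (hF : Differentiable ℝ F) (q : ℝ × ℝ) :
    HasDerivAt (fun u => F (q.1, u)) (fderiv ℝ F q (0, 1)) q.2 :=
  HasFDerivAt.comp_hasDerivAt q.2 (hF q).hasFDerivAt
    ((hasDerivAt_const _ _).prodMk (hasDerivAt_id q.2))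

theorem hasDerivAt_ofReal_cos_mul (a u : ℝ) :
    HasDerivAt (fun u : ℝ => (Real.cos (a * u) : ℂ)) (-(a * Real.sin (a * u)) : ℝ) u := by
  have h := ((Real.hasDerivAt_cos (a * u)).comp u ((hasDerivAt_id u).const_mul a)).ofReal_comp
  refine h.congr_deriv ?_
  push_cast
  ring

/-- Green's identity on a rectangle for the function `h(r) sin (a u)` and a test function `W`, with
the metric `½ ∂ᵣ² + 2 ∂ᵤ²`. At `u = d` the normal derivative of the sine vanishes; at `u = 0` it does
not, and the values of `W` on that side remain. -/
theorem integral_rectangle_green {h : ℝ → ℂ} (hh : ContDiff ℝ ∞ h) {W : ℝ × ℝ → ℂ}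
    (hW : ContDiff ℝ ∞ W) {T d a : ℝ} (hT : 0 ≤ T) (hd : 0 ≤ d) (had : a * d = Real.pi / 2)
    (h0 : deriv h 0 = 0) (hT0 : deriv h T = 0) :
    ∫ q in Set.Icc ((0 : ℝ), (0 : ℝ)) (T, d),
      ((1 / 2 : ℂ) * deriv h q.1 * Real.sin (a * q.2) * fderiv ℝ W q (1, 0)
        + 2 * a * h q.1 * Real.cos (a * q.2) * fderiv ℝ W q (0, 1)
        - (2 * a ^ 2 * h q.1 - (1 / 2 : ℂ) * deriv (deriv h) q.1) * Real.sin (a * q.2) * W q)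
      = -(2 * a * ∫ r in (0)..T, h r * W (r, 0)) := by
  have hh1 : ContDiff ℝ ∞ (deriv h) := hh.deriv'
  have hs : ContDiff ℝ ∞ fun q : ℝ × ℝ => (Real.sin (a * q.2) : ℂ) :=
    Complex.ofRealCLM.contDiff.comp (Real.contDiff_sin.comp (contDiff_const.mul contDiff_snd))
  have hc : ContDiff ℝ ∞ fun q : ℝ × ℝ => (Real.cos (a * q.2) : ℂ) :=
    Complex.ofRealCLM.contDiff.comp (Real.contDiff_cos.comp (contDiff_const.mul contDiff_snd))
  obtain ⟨f, hf⟩ : ∃ f : ℝ × ℝ → ℂ, ∀ q,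
      f q = (1 / 2 : ℂ) * deriv h q.1 * Real.sin (a * q.2) * W q := ⟨_, fun _ => rfl⟩
  obtain ⟨g, hg⟩ : ∃ g : ℝ × ℝ → ℂ, ∀ q,
      g q = 2 * a * h q.1 * Real.cos (a * q.2) * W q := ⟨_, fun _ => rfl⟩
  have hfs : ContDiff ℝ ∞ f := by
    rw [funext hf]
    exact ((contDiff_const.mul (hh1.comp contDiff_fst)).mul hs).mul hW
  have hgs : ContDiff ℝ ∞ g := by
    rw [funext hg]
    exact ((contDiff_const.mul (hh.comp contDiff_fst)).mul hc).mul hW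
  have dW : Differentiable ℝ W := hW.differentiable (by simp)
  have df : ∀ q, fderiv ℝ f q (1, 0) = (1 / 2 : ℂ) * deriv (deriv h) q.1 * Real.sin (a * q.2) * W q
      + (1 / 2 : ℂ) * deriv h q.1 * Real.sin (a * q.2) * fderiv ℝ W q (1, 0) := fun q => by
    refine fderiv_apply_one_zero_eq_of_hasDerivAt (hfs.differentiable (by simp)) ?_
    simp only [hf]
    exact (((hh1.differentiable (by simp) q.1).hasDerivAt.const_mul (1 / 2 : ℂ)).mul_const _).mul
      (hasDerivAt_line_fst dW q)
  have dg : ∀ q, fderiv ℝ g q (0, 1)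
      = 2 * a * h q.1 * ((-(a * Real.sin (a * q.2)) : ℝ) : ℂ) * W q
      + 2 * a * h q.1 * Real.cos (a * q.2) * fderiv ℝ W q (0, 1) := fun q => by
    refine fderiv_apply_zero_one_eq_of_hasDerivAt (hgs.differentiable (by simp)) ?_
    simp only [hg]
    exact ((hasDerivAt_ofReal_cos_mul a q.2).const_mul _).mul (hasDerivAt_line_snd dW q)
  -- the divergence theorem for the field `(f, g)`
  have hdiv := integral_divergence_prod_Icc_of_hasFDerivAt_of_le f g (fderiv ℝ f) (fderiv ℝ g)
    (0, 0) (T, d) ⟨hT, hd⟩ hfs.continuous.continuousOn hgs.continuous.continuousOn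
    (fun q _ => (hfs.differentiable (by simp) q).hasFDerivAt)
    (fun q _ => (hgs.differentiable (by simp) q).hasFDerivAt)
    (((continuous_fderiv_apply hfs _).add
      (continuous_fderiv_apply hgs _)).continuousOn.integrableOn_compact isCompact_Icc)
  have b1 : ∀ u, f (T, u) = 0 := fun u => by simp [hf, hT0]
  have b2 : ∀ u, f (0, u) = 0 := fun u => by simp [hf, h0]
  have b3 : ∀ r, g (r, d) = 0 := fun r => by simp [hg, had]
  have b4 : ∀ r, g (r, 0) = 2 * a * (h r * W (r, 0)) := fun r => by
    simp only [hg, mul_zero, Real.cos_zero, Complex.ofReal_one]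
    ring
  simp only [b1, b2, b3, b4, intervalIntegral.integral_zero, add_zero, sub_zero, zero_sub,
    intervalIntegral.integral_const_mul] at hdiv
  rw [← hdiv]
  refine integral_congr_ae (Eventually.of_forall fun q => ?_)
  simp only [df, dg]
  push_cast
  ring

/-- A smooth, compactly supported function on the line that agrees with `cos (a t)` near
`[-d, d]`. -/
theorem exists_transverse_profile (a : ℝ) {d : ℝ} (hd : 0 < d) :
    ∃ χ : ℝ → ℝ, ContDiff ℝ ∞ χ ∧ HasCompactSupport χ ∧
      ∀ t, |t| ≤ d → χ t = Real.cos (a * t) ∧ deriv χ t = -(a * Real.sin (a * t)) := by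
  let b : ContDiffBump (0 : ℝ) := ⟨2 * d, 3 * d, by linarith, by linarith⟩
  have hcos : ContDiff ℝ ∞ fun t : ℝ => Real.cos (a * t) :=
    Real.contDiff_cos.comp (contDiff_const.mul contDiff_id)
  refine ⟨fun t => b t * Real.cos (a * t), b.contDiff.mul hcos, b.hasCompactSupport.mul_right,
    fun t ht => ?_⟩
  have hev : (fun t => b t * Real.cos (a * t)) =ᶠ[𝓝 t] fun t => Real.cos (a * t) := by
    have hmem : t ∈ Metric.ball (0 : ℝ) b.rIn := by
      rw [Metric.mem_ball, Real.dist_eq, sub_zero]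
      exact ht.trans_lt (show d < 2 * d by linarith)
    filter_upwards [b.eventuallyEq_one_of_mem_ball hmem] with s hs
    simp [hs]
  refine ⟨hev.eq_of_nhds, hev.deriv_eq.trans ?_⟩
  have := ((Real.hasDerivAt_cos (a * t)).comp t ((hasDerivAt_id t).const_mul a)).deriv
  refine this.trans ?_
  simp [mul_comm]

/-- The function on the plane with longitudinal profile `f`, in the mean coordinate `(x + y) / 2`,
and transverse profile `χ`, in the relative coordinate `x - y`. -/
def mode (f : ℝ → ℂ) (χ : ℝ → ℝ) (p : ℝ × ℝ) : ℂ := f ((p.1 + p.2) / 2) * χ (p.1 - p.2)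

theorem contDiff_mode {f : ℝ → ℂ} {χ : ℝ → ℝ} (hf : ContDiff ℝ ∞ f) (hχ : ContDiff ℝ ∞ χ) :
    ContDiff ℝ ∞ (mode f χ) := by
  have h1 : ContDiff ℝ ∞ fun p : ℝ × ℝ => (χ (p.1 - p.2) : ℂ) :=
    Complex.ofRealCLM.contDiff.comp (hχ.comp (contDiff_fst.sub contDiff_snd))
  exact (hf.comp ((contDiff_fst.add contDiff_snd).div_const 2)).mul h1

theorem hasCompactSupport_mode {f : ℝ → ℂ} {χ : ℝ → ℝ} (hf : HasCompactSupport f)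
    (hχ : HasCompactSupport χ) : HasCompactSupport (mode f χ) := by
  refine HasCompactSupport.intro ((hf.isCompact.prod hχ.isCompact).image
    (contDiff_frame (o := 0) (e₁ := (1, 1)) (e₂ := (1 / 2, -1 / 2))).continuous) fun p hp => ?_
  by_contra hne
  refine hp ⟨((p.1 + p.2) / 2, p.1 - p.2), ⟨subset_tsupport _ fun h => hne ?_,
    subset_tsupport _ fun h => hne ?_⟩, ?_⟩
  · rw [mode, h, zero_mul]
  · rw [mode, h, Complex.ofReal_zero, mul_zero]
  · ext <;> simp [frame] <;> ring

theorem fderiv_mode {f : ℝ → ℂ} {χ : ℝ → ℝ} (hf : Differentiable ℝ f)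
    (hχ : Differentiable ℝ χ) (p e : ℝ × ℝ) : fderiv ℝ (mode f χ) p e
      = ((e.1 + e.2) / 2 : ℝ) * deriv f ((p.1 + p.2) / 2) * χ (p.1 - p.2)
        + (e.1 - e.2 : ℝ) * f ((p.1 + p.2) / 2) * deriv χ (p.1 - p.2) := by
  have l1 : HasDerivAt (fun s : ℝ => ((p + s • e).1 + (p + s • e).2) / 2) ((e.1 + e.2) / 2) 0 := by
    have := (((hasDerivAt_id (0 : ℝ)).mul_const (e.1 + e.2)).add_const (p.1 + p.2)).div_const 2
    refine (this.congr_deriv (by simp)).congr_of_eventuallyEq (Eventually.of_forall fun s => ?_)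
    simp
    ring
  have l2 : HasDerivAt (fun s : ℝ => (p + s • e).1 - (p + s • e).2) (e.1 - e.2) 0 := by
    have := ((hasDerivAt_id (0 : ℝ)).mul_const (e.1 - e.2)).add_const (p.1 - p.2)
    refine (this.congr_deriv (by simp)).congr_of_eventuallyEq (Eventually.of_forall fun s => ?_)
    simp
    ring
  have l3 : HasDerivAt (fun s : ℝ => p + s • e) e 0 := by
    simpa using ((hasDerivAt_id (0 : ℝ)).smul_const e).const_add p
  have l4 := HasDerivAt.scomp (0 : ℝ) (hf _).hasDerivAt l1
  have l5 := (HasDerivAt.comp (0 : ℝ) (hχ _).hasDerivAt l2).ofReal_comp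
  have hd : DifferentiableAt ℝ (mode f χ) p := by
    have h1 : DifferentiableAt ℝ (fun p : ℝ × ℝ => (χ (p.1 - p.2) : ℂ)) p :=
      Complex.ofRealCLM.differentiableAt.comp p
        ((hχ _).comp p (differentiableAt_fst.sub differentiableAt_snd))
    have h2 : DifferentiableAt ℝ (fun p : ℝ × ℝ => (p.1 + p.2) / 2) p := by fun_prop
    exact ((hf _).comp p h2).mul h1
  have l6 : HasDerivAt (fun s : ℝ => mode f χ (p + s • e)) (fderiv ℝ (mode f χ) p e) 0 := by
    have h0 : p = p + (0 : ℝ) • e := by simp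
    rw [h0] at hd
    have := HasFDerivAt.comp_hasDerivAt (0 : ℝ) hd.hasFDerivAt l3
    rwa [← h0] at this
  rw [l6.unique (l4.mul l5)]
  simp
  ring

/-! ### Green's identity on a half-strip -/

section

/-- The properties of the transverse profile: a test function that is `cos (a t)`
for `|t| ≤ d`. -/
structure IsProfile (a d : ℝ) (χ : ℝ → ℝ) : Prop where
  contDiff : ContDiff ℝ ∞ χ
  hasCompactSupport : HasCompactSupport χ
  eq_cos : ∀ t, |t| ≤ d → χ t = Real.cos (a * t)
  deriv_eq : ∀ t, |t| ≤ d → deriv χ t = -(a * Real.sin (a * t))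

/-- The longitudinal profile of `-Δ` applied to the mode with longitudinal profile `f`. -/
def laplaceProfile (a : ℝ) (f : ℝ → ℂ) (c : ℝ) : ℂ :=
  2 * a ^ 2 * f c - (1 / 2 : ℂ) * deriv (deriv f) c

theorem contDiff_laplaceProfile (a : ℝ) {f : ℝ → ℂ} (hf : ContDiff ℝ ∞ f) :
    ContDiff ℝ ∞ (laplaceProfile a f) :=
  (contDiff_const.mul hf).sub (contDiff_const.mul hf.deriv'.deriv')

theorem deriv_eq_zero_of_notMem_tsupport {f : ℝ → ℂ} {c : ℝ} (h : c ∉ tsupport f) :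
    deriv f c = 0 :=
  image_eq_zero_of_notMem_tsupport fun h' => h (tsupport_deriv_subset h')

theorem laplaceProfile_eq_zero (a : ℝ) {f : ℝ → ℂ} {c : ℝ} (h : c ∉ tsupport f) :
    laplaceProfile a f c = 0 := by
  have h1 : c ∉ tsupport (deriv f) := fun h' => h (tsupport_deriv_subset h')
  rw [laplaceProfile, image_eq_zero_of_notMem_tsupport h, deriv_eq_zero_of_notMem_tsupport h1]
  simp

theorem hasCompactSupport_laplaceProfile (a : ℝ) {f : ℝ → ℂ} (hf : HasCompactSupport f) :
    HasCompactSupport (laplaceProfile a f) :=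
  HasCompactSupport.intro hf.isCompact fun _ hc => laplaceProfile_eq_zero a hc

/-- The region `R` is a half-strip: the one below the diagonal if `ε = 1`, the one above it
if `ε = -1`. The coordinate `r` runs along the outer side, and `u` runs across the half-strip, from
the outer side `u = 0` to the diagonal `u = d`; thus `(x + y) / 2 = r + d / 2` and
`x - y = ε (d - u)`. -/
structure IsHalfStrip (d ε : ℝ) (o e₂ : ℝ × ℝ) (R : Set (ℝ × ℝ)) : Prop where
  swept : IsSwept o (1, 1) e₂ R (Set.Ici 0) d (fun _ => d)
  sq_eq : ε ^ 2 = 1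
  origin_eq : o = ((1 + ε) / 2 * d, (1 - ε) / 2 * d)
  axis_eq : e₂ = (-ε / 2, ε / 2)

variable {a d ε : ℝ} {o e₂ : ℝ × ℝ} {R : Set (ℝ × ℝ)} {f : ℝ → ℂ} {χ : ℝ → ℝ}

theorem IsHalfStrip.mean_coordinate (hs : IsHalfStrip d ε o e₂ R) (q : ℝ × ℝ) :
    ((frame o (1, 1) e₂ q).1 + (frame o (1, 1) e₂ q).2) / 2 = q.1 + d / 2 := by
  simp [frame, hs.origin_eq, hs.axis_eq]
  ring

theorem IsHalfStrip.relative_coordinate (hs : IsHalfStrip d ε o e₂ R) (q : ℝ × ℝ) :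
    (frame o (1, 1) e₂ q).1 - (frame o (1, 1) e₂ q).2 = ε * (d - q.2) := by
  simp [frame, hs.origin_eq, hs.axis_eq]
  ring

theorem IsHalfStrip.abs_mul_le (hs : IsHalfStrip d ε o e₂ R) {u : ℝ} (hu : u ∈ Set.Icc 0 d) :
    |ε * (d - u)| ≤ d := by
  have hε : |ε| = 1 := by
    rw [← abs_one]
    exact (sq_eq_sq_iff_abs_eq_abs _ _).mp (by rw [hs.sq_eq, one_pow])
  rw [abs_mul, hε, one_mul, abs_le]
  constructor <;> linarith [hu.1, hu.2]

theorem IsHalfStrip.cos_eq (hs : IsHalfStrip d ε o e₂ R) (had : a * d = Real.pi / 2) (u : ℝ) :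
    Real.cos (a * (ε * (d - u))) = Real.sin (a * u) := by
  have hang : a * (d - u) = Real.pi / 2 - a * u := by rw [mul_sub, had]
  rcases sq_eq_sq_iff_eq_or_eq_neg.mp (hs.sq_eq.trans (one_pow 2).symm) with h | h <;> rw [h]
  · rw [one_mul, hang, Real.cos_pi_div_two_sub]
  · rw [neg_one_mul, mul_neg, Real.cos_neg, hang, Real.cos_pi_div_two_sub]

theorem IsHalfStrip.sin_eq (hs : IsHalfStrip d ε o e₂ R) (had : a * d = Real.pi / 2) (u : ℝ) :
    Real.sin (a * (ε * (d - u))) = ε * Real.cos (a * u) := by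
  have hang : a * (d - u) = Real.pi / 2 - a * u := by rw [mul_sub, had]
  rcases sq_eq_sq_iff_eq_or_eq_neg.mp (hs.sq_eq.trans (one_pow 2).symm) with h | h <;> rw [h]
  · rw [one_mul, hang, Real.sin_pi_div_two_sub, one_mul]
  · rw [neg_one_mul, mul_neg, Real.sin_neg, hang, Real.sin_pi_div_two_sub, neg_one_mul]

theorem IsHalfStrip.setIntegral_green_of_contDiff (hs : IsHalfStrip d ε o e₂ R) (hd : 0 < d)
    (had : a * d = Real.pi / 2) (hχ : IsProfile a d χ) (hf : ContDiff ℝ ∞ f) {T : ℝ}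
    (hT : 0 ≤ T) (hft : tsupport f ⊆ Set.Ioo (d / 2) T) {w : ℝ × ℝ → ℂ} (hw : ContDiff ℝ ∞ w) :
    ∫ p in R, (fderiv ℝ (mode f χ) p (1, 0) * fderiv ℝ w p (1, 0)
        + fderiv ℝ (mode f χ) p (0, 1) * fderiv ℝ w p (0, 1)
        - mode (laplaceProfile a f) χ p * w p)
      = -(2 * a * ∫ r in (0)..T, f (r + d / 2) * w (frame o (1, 1) e₂ (r, 0))) := by
  have hsw := hs.swept
  have hW : ContDiff ℝ ∞ (w ∘ frame o (1, 1) e₂) := hw.comp contDiff_frame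
  have hh : ContDiff ℝ ∞ fun r => f (r + d / 2) := hf.comp (contDiff_id.add contDiff_const)
  have hh1 : ∀ r, deriv (fun r => f (r + d / 2)) r = deriv f (r + d / 2) := fun r =>
    deriv_comp_add_const f (d / 2) r
  have hh2 : ∀ r, deriv (deriv fun r => f (r + d / 2)) r = deriv (deriv f) (r + d / 2) := by
    intro r
    rw [funext hh1]
    exact deriv_comp_add_const (deriv f) (d / 2) r
  have hz : ∀ r, r ≤ 0 ∨ T ≤ r → r + d / 2 ∉ tsupport f := by
    rintro r (h | h) hr
    · linarith [(hft hr).1]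
    · linarith [(hft hr).2]
  have hg := integral_rectangle_green hh hW hT hd.le had
    (by rw [hh1]; exact deriv_eq_zero_of_notMem_tsupport (hz 0 (.inl le_rfl)))
    (by rw [hh1]; exact deriv_eq_zero_of_notMem_tsupport (hz T (.inr le_rfl)))
  simp only [hh1, hh2, fderiv_comp_frame hw] at hg
  refine Eq.trans ?_ hg
  have hf1 : Differentiable ℝ f := hf.differentiable (by simp)
  have hχ1 : Differentiable ℝ χ := hχ.contDiff.differentiable (by simp)
  rw [setIntegral_comp_frame (o := o) hsw.unimodular, setIntegral_eq_of_subset_of_forall_sdiff_eq_zero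
    (hsw.measurableSet.preimage (measurableEmbedding_frame hsw.unimodular).measurable)
    (s := Set.Icc ((0 : ℝ), (0 : ℝ)) (T, d))]
  · refine setIntegral_congr_fun measurableSet_Icc fun q hq => ?_
    have habs := hs.abs_mul_le (u := q.2) ⟨hq.1.2, hq.2.2⟩
    have hax : ∀ v : ℝ × ℝ, fderiv ℝ w (frame o (1, 1) e₂ q) v
        = (v.1 : ℂ) * fderiv ℝ w (frame o (1, 1) e₂ q) (1, 0)
          + (v.2 : ℂ) * fderiv ℝ w (frame o (1, 1) e₂ q) (0, 1) := fun v => fderiv_apply_eq _ _ v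
    simp only [fderiv_mode hf1 hχ1, mode, laplaceProfile, hs.mean_coordinate,
      hs.relative_coordinate, hχ.eq_cos _ habs, hχ.deriv_eq _ habs, hs.cos_eq had, hs.sin_eq had,
      Function.comp_apply]
    rw [hax ((1 : ℝ) • ((1 : ℝ), (1 : ℝ)) + (0 : ℝ) • e₂),
      hax ((0 : ℝ) • ((1 : ℝ), (1 : ℝ)) + (1 : ℝ) • e₂), hs.axis_eq]
    simp only [Prod.fst_add, Prod.snd_add, Prod.smul_fst, Prod.smul_snd, smul_eq_mul]
    push_cast
    ring
  · intro q hq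
    exact (hsw.mem_iff q.1 q.2).mpr ⟨hq.1.1, hq.1.2, hq.2.2⟩
  · rintro q ⟨hq1, hq2⟩
    obtain ⟨m1, m2⟩ := (hsw.mem_iff q.1 q.2).mp hq1
    have hqT : T ≤ q.1 := by
      by_contra hlt
      exact hq2 ⟨⟨m1, m2.1⟩, ⟨(not_le.mp hlt).le, m2.2⟩⟩
    have hn := hz q.1 (.inr hqT)
    simp only [fderiv_mode hf1 hχ1, mode, hs.mean_coordinate, laplaceProfile_eq_zero a hn,
      image_eq_zero_of_notMem_tsupport hn, deriv_eq_zero_of_notMem_tsupport hn]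
    simp

theorem integrable_mul_of_memLp_two {X : Type*} [MeasurableSpace X] {μ : Measure X}
    {g f : X → ℂ} (hg : MemLp g 2 μ) (hf : MemLp f 2 μ) : Integrable (fun x => g x * f x) μ :=
  hg.integrable_mul hf

theorem integral_mul_add_mul_sub_mul {X : Type*} [MeasurableSpace X] {μ : Measure X}
    {g₁ g₂ g₃ f₁ f₂ f₃ : X → ℂ} (hg₁ : MemLp g₁ 2 μ) (hg₂ : MemLp g₂ 2 μ) (hg₃ : MemLp g₃ 2 μ)
    (hf₁ : MemLp f₁ 2 μ) (hf₂ : MemLp f₂ 2 μ) (hf₃ : MemLp f₃ 2 μ) :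
    ∫ x, (g₁ x * f₁ x + g₂ x * f₂ x - g₃ x * f₃ x) ∂μ
      = (∫ x, g₁ x * f₁ x ∂μ) + (∫ x, g₂ x * f₂ x ∂μ) - ∫ x, g₃ x * f₃ x ∂μ := by
  have i1 := integrable_mul_of_memLp_two hg₁ hf₁
  have i2 := integrable_mul_of_memLp_two hg₂ hf₂
  have i3 := integrable_mul_of_memLp_two hg₃ hf₃
  rw [← integral_add i1 i2]
  exact integral_sub (i1.add i2) i3

/-- Green's identity on a half-strip for a mode `φ` and an `H¹` function `F` with zero trace on the
outer side: `∫ (∇φ · ∇F + Δφ F) = 0`. There is no contribution of the diagonal, where the normal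
derivative of `φ` vanishes. -/
theorem IsHalfStrip.setIntegral_green (hs : IsHalfStrip d ε o e₂ R) (hR : R ⊆ pencil d)
    (hd : 0 < d) (had : a * d = Real.pi / 2) (hχ : IsProfile a d χ) (hf : ContDiff ℝ ∞ f) {T : ℝ}
    (hft : tsupport f ⊆ Set.Ioo (d / 2) T) {c : ℝ → ℝ × ℝ}
    (hc : ∀ r, frame o (1, 1) e₂ (r, 0) = c r) {F : Jet (pencil d)}
    (hF : HasTrace (pencil d) c (Set.Ici 0) F 0) :
    ∫ p in R, (fderiv ℝ (mode f χ) p (1, 0) * F.2.1 p + fderiv ℝ (mode f χ) p (0, 1) * F.2.2 p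
        - mode (laplaceProfile a f) χ p * F.1 p) = 0 := by
  obtain ⟨T, hT, hft⟩ : ∃ T, 0 ≤ T ∧ tsupport f ⊆ Set.Ioo (d / 2) T :=
    ⟨max T 0, le_max_right _ _, hft.trans (Set.Ioo_subset_Ioo_right (le_max_left _ _))⟩
  have hfc : HasCompactSupport f :=
    isCompact_Icc.of_isClosed_subset (isClosed_tsupport f) (hft.trans Set.Ioo_subset_Icc_self)
  obtain ⟨w, hw, t0, t1, t2, tg⟩ := hF
  have hle : (volume.restrict R : Measure (ℝ × ℝ)) ≤ volume.restrict (pencil d) :=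
    Measure.restrict_mono hR le_rfl
  have φ1 := contDiff_mode hf hχ.contDiff
  have φ2 := hasCompactSupport_mode hfc hχ.hasCompactSupport
  have ψ1 := contDiff_mode (contDiff_laplaceProfile a hf) hχ.contDiff
  have ψ2 := hasCompactSupport_mode (hasCompactSupport_laplaceProfile a hfc) hχ.hasCompactSupport
  have p1 := memLp_fderiv_apply φ1 φ2 R (1, 0)
  have p2 := memLp_fderiv_apply φ1 φ2 R (0, 1)
  have p3 := memLp_of_contDiff ψ1 ψ2 R
  have hlim := ((tendsto_integral_mul_of_tendsto_eLpNorm p1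
      (fun n => memLp_fderiv_apply (hw n).1 (hw n).2 R (1, 0))
      ((Lp.memLp F.2.1).mono_measure hle) (tendsto_eLpNorm_restrict hle t1)).add
    (tendsto_integral_mul_of_tendsto_eLpNorm p2
      (fun n => memLp_fderiv_apply (hw n).1 (hw n).2 R (0, 1))
      ((Lp.memLp F.2.2).mono_measure hle) (tendsto_eLpNorm_restrict hle t2))).sub
    (tendsto_integral_mul_of_tendsto_eLpNorm p3
      (fun n => memLp_of_contDiff (hw n).1 (hw n).2 R)
      ((Lp.memLp F.1).mono_measure hle) (tendsto_eLpNorm_restrict hle t0))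
  rw [← integral_mul_add_mul_sub_mul p1 p2 p3 ((Lp.memLp F.2.1).mono_measure hle)
    ((Lp.memLp F.2.2).mono_measure hle) ((Lp.memLp F.1).mono_measure hle)] at hlim
  refine tendsto_nhds_unique hlim ?_
  have hIoc : (volume.restrict (Set.Ioc 0 T) : Measure ℝ) ≤ volume.restrict (Set.Ici 0) :=
    Measure.restrict_mono (fun r hr => hr.1.le) le_rfl
  have hfr : Continuous (frame o (1, 1) e₂) := contDiff_frame.continuous
  have hside := tendsto_integral_mul_of_tendsto_eLpNorm (μ := volume.restrict (Set.Ioc 0 T))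
    (g := fun r => f (r + d / 2))
    (((hf.continuous.comp (continuous_id.add continuous_const)).memLp_of_hasCompactSupport
      (hfc.comp_homeomorph (Homeomorph.addRight (d / 2)))).restrict _)
    (fun n => by
      have hcn := (hw n).1.continuous
      have := (Continuous.memLp_of_hasCompactSupport (μ := volume) (p := 2)
        (show Continuous fun r : ℝ => w n (frame o (1, 1) e₂ (r, 0)) by fun_prop)
        (hasCompactSupport_frame_line hs.swept.unimodular (hw n).2)).restrict (Set.Ioc 0 T)
      simpa only [hc] using this)
    ((Lp.memLp (0 : L2line (Set.Ici 0))).mono_measure hIoc) (tendsto_eLpNorm_restrict hIoc tg)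
  have hz : ∫ r in Set.Ioc 0 T, f (r + d / 2) * (0 : L2line (Set.Ici 0)) r = 0 := by
    refine integral_eq_zero_of_ae (ae_mono hIoc ?_)
    filter_upwards [Lp.coeFn_zero ℂ 2 (volume.restrict (Set.Ici (0 : ℝ)))] with r hr
    rw [hr]
    simp
  rw [hz] at hside
  have hside' := (hside.const_mul (2 * a : ℂ)).neg
  rw [mul_zero, neg_zero] at hside'
  refine hside'.congr fun n => ?_
  rw [← integral_mul_add_mul_sub_mul p1 p2 p3 (memLp_fderiv_apply (hw n).1 (hw n).2 R (1, 0))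
    (memLp_fderiv_apply (hw n).1 (hw n).2 R (0, 1)) (memLp_of_contDiff (hw n).1 (hw n).2 R),
    hs.setIntegral_green_of_contDiff hd had hχ hf hT hft (hw n).1,
    intervalIntegral.integral_of_le hT]
  simp only [hc]

end

/-! ### Norms of modes and the weak interaction far out -/

section

variable {a d ε : ℝ} {o e₂ : ℝ × ℝ} {R : Set (ℝ × ℝ)} {f : ℝ → ℂ} {χ : ℝ → ℝ}

theorem norm_integral_mul_le {X : Type*} [MeasurableSpace X] {μ : Measure X} {g f : X → ℂ}
    (hg : MemLp g 2 μ) (hf : MemLp f 2 μ) :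
    ‖∫ x, g x * f x ∂μ‖ ≤ √(∫ x, ‖g x‖ ^ 2 ∂μ) * √(∫ x, ‖f x‖ ^ 2 ∂μ) := by
  have hg' : MemLp (fun x => star (g x)) 2 μ := hg.star
  have key : ∫ x, g x * f x ∂μ = inner ℂ (hg'.toLp _) (hf.toLp f) := by
    rw [L2.inner_def]
    refine integral_congr_ae ?_
    filter_upwards [hg'.coeFn_toLp, hf.coeFn_toLp] with x h1 h2
    rw [h1, h2]
    simp [mul_comm]
  have h1 : ∫ x, ‖g x‖ ^ 2 ∂μ = ‖hg'.toLp _‖ ^ 2 := by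
    rw [← integral_norm_sq_eq_norm_toLp hg']
    simp
  rw [key, h1, integral_norm_sq_eq_norm_toLp hf, Real.sqrt_sq (norm_nonneg _),
    Real.sqrt_sq (norm_nonneg _)]
  exact norm_inner_le_norm _ _

theorem isHalfStrip_lowerStrip (hd : 0 < d) :
    IsHalfStrip d 1 (d, 0) (-1 / 2, 1 / 2) (lowerStrip d) where
  swept := isSwept_lowerStrip hd
  sq_eq := one_pow 2
  origin_eq := by norm_num
  axis_eq := rfl

theorem isHalfStrip_upperStrip (hd : 0 < d) :
    IsHalfStrip d (-1) (0, d) (1 / 2, -1 / 2) (upperStrip d) where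
  swept := isSwept_upperStrip hd
  sq_eq := by norm_num
  origin_eq := by norm_num
  axis_eq := by norm_num

theorem integral_sin_mul_sq (ha : a ≠ 0) (had : a * d = Real.pi / 2) :
    ∫ u in (0)..d, Real.sin (a * u) ^ 2 = d / 2 := by
  rw [intervalIntegral.integral_comp_mul_left (fun x => Real.sin x ^ 2) ha, integral_sin_sq, had]
  simp
  field_simp
  linarith

theorem IsHalfStrip.setIntegral_norm_sq_mode (hs : IsHalfStrip d ε o e₂ R) (ha : a ≠ 0)
    (had : a * d = Real.pi / 2) (hχ : IsProfile a d χ) (hf : ContDiff ℝ ∞ f)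
    (hfc : HasCompactSupport f) (hf0 : ∀ c ≤ d / 2, f c = 0) :
    ∫ p in R, ‖mode f χ p‖ ^ 2 = d / 2 * ∫ c, ‖f c‖ ^ 2 := by
  have hφ := contDiff_mode hf hχ.contDiff
  have hφc := hφ.continuous
  rw [(setIntegral_eq_integral_slices hs.swept.unimodular hs.swept.measurableSet
    measurableSet_Ici hs.swept.nonneg hs.swept.mem_iff (f := fun p => ‖mode f χ p‖ ^ 2)
    (by fun_prop)
    (hasCompactSupport_norm_sq (hasCompactSupport_mode hfc hχ.hasCompactSupport))).1]
  have hd : 0 ≤ d := hs.swept.nonneg 0 Set.self_mem_Ici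
  have h1 : ∀ r, ∫ u in (0)..d, ‖mode f χ (frame o (1, 1) e₂ (r, u))‖ ^ 2
      = d / 2 * ‖f (r + d / 2)‖ ^ 2 := by
    intro r
    refine Eq.trans ?_ (congrArg (fun x => x * ‖f (r + d / 2)‖ ^ 2) (integral_sin_mul_sq ha had))
    simp only [← intervalIntegral.integral_mul_const]
    refine intervalIntegral.integral_congr fun u hu => ?_
    rw [Set.uIcc_of_le hd] at hu
    simp only [mode, hs.mean_coordinate, hs.relative_coordinate,
      hχ.eq_cos _ (hs.abs_mul_le hu), hs.cos_eq had]
    rw [norm_mul, Complex.norm_real, mul_pow, Real.norm_eq_abs, sq_abs, mul_comm]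
  simp only [h1]
  rw [integral_const_mul, setIntegral_eq_integral_of_forall_compl_eq_zero,
    integral_add_right_eq_self (fun c => ‖f c‖ ^ 2)]
  intro r hr
  have hr' : r < 0 := not_le.mp hr
  rw [hf0 _ (by linarith), norm_zero]
  norm_num

theorem setIntegral_pencil_eq_strips {E : Type*} [NormedAddCommGroup E] [NormedSpace ℝ E]
    {g : ℝ × ℝ → E} (hg : IntegrableOn g (pencil d)) (h0 : ∀ p, p.1 + p.2 ≤ d → g p = 0) :
    ∫ p in pencil d, g p = (∫ p in lowerStrip d, g p) + ∫ p in upperStrip d, g p := by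
  rw [setIntegral_pencil hg,
    setIntegral_eq_zero_of_forall_eq_zero (t := lowerTriangle d) fun p hp => h0 p hp.2.2,
    setIntegral_eq_zero_of_forall_eq_zero (t := upperTriangle d) fun p hp => h0 p hp.2.2,
    add_zero, zero_add]

theorem setIntegral_pencil_norm_sq_mode (hd : 0 < d) (ha : a ≠ 0) (had : a * d = Real.pi / 2)
    (hχ : IsProfile a d χ) (hf : ContDiff ℝ ∞ f) (hfc : HasCompactSupport f)
    (hf0 : ∀ c ≤ d / 2, f c = 0) :
    ∫ p in pencil d, ‖mode f χ p‖ ^ 2 = d * ∫ c, ‖f c‖ ^ 2 := by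
  have hφ := contDiff_mode hf hχ.contDiff
  have hφc := hφ.continuous
  rw [setIntegral_pencil_eq_strips, (isHalfStrip_lowerStrip hd).setIntegral_norm_sq_mode ha had hχ
    hf hfc hf0, (isHalfStrip_upperStrip hd).setIntegral_norm_sq_mode ha had hχ hf hfc hf0]
  · ring
  · exact (Continuous.integrable_of_hasCompactSupport (by fun_prop)
      (hasCompactSupport_norm_sq
        (hasCompactSupport_mode hfc hχ.hasCompactSupport))).integrableOn
  · intro p hp
    rw [mode, hf0 _ (by linarith), zero_mul, norm_zero]
    norm_num

/-- Green's identity on the pencil for a mode supported in the strip. -/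
theorem setIntegral_pencil_green (hd : 0 < d) (had : a * d = Real.pi / 2) (hχ : IsProfile a d χ)
    (hf : ContDiff ℝ ∞ f) {T : ℝ} (hft : tsupport f ⊆ Set.Ioo (d / 2) T) {F : FormData d}
    (hF : InFormDomain d F) :
    ∫ p in pencil d, (fderiv ℝ (mode f χ) p (1, 0) * F.1.2.1 p
        + fderiv ℝ (mode f χ) p (0, 1) * F.1.2.2 p
        - mode (laplaceProfile a f) χ p * F.1.1 p) = 0 := by
  have hfc : HasCompactSupport f :=
    isCompact_Icc.of_isClosed_subset (isClosed_tsupport f) (hft.trans Set.Ioo_subset_Icc_self)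
  have φ1 := contDiff_mode hf hχ.contDiff
  have φ2 := hasCompactSupport_mode hfc hχ.hasCompactSupport
  have ψ1 := contDiff_mode (contDiff_laplaceProfile a hf) hχ.contDiff
  have ψ2 := hasCompactSupport_mode (hasCompactSupport_laplaceProfile a hfc) hχ.hasCompactSupport
  have hz : ∀ c ≤ d / 2, c ∉ tsupport f := fun c hc h => absurd (hft h).1 (not_lt.mpr hc)
  rw [setIntegral_pencil_eq_strips,
    (isHalfStrip_lowerStrip hd).setIntegral_green (lowerStrip_subset d) hd had hχ hf hft
      (frame_lowerStrip_zero d) hF.2.1,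
    (isHalfStrip_upperStrip hd).setIntegral_green (upperStrip_subset d) hd had hχ hf hft
      (frame_upperStrip_zero d) hF.2.2.1, add_zero]
  · exact (((memLp_fderiv_apply φ1 φ2 _ (1, 0)).integrable_mul (Lp.memLp F.1.2.1)).add
      ((memLp_fderiv_apply φ1 φ2 _ (0, 1)).integrable_mul (Lp.memLp F.1.2.2))).sub
      ((memLp_of_contDiff ψ1 ψ2 _).integrable_mul (Lp.memLp F.1.1))
  · intro p hp
    have hn := hz ((p.1 + p.2) / 2) (by linarith)
    simp only [fderiv_mode (hf.differentiable (by simp)) (hχ.contDiff.differentiable (by simp)),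
      mode, laplaceProfile_eq_zero a hn, image_eq_zero_of_notMem_tsupport hn,
      deriv_eq_zero_of_notMem_tsupport hn]
    simp

/-- The Cauchy–Schwarz inequality with the weight `α ≥ 0`. The weighted norm of `u` is controlled
by the form, so no trace inequality is needed. -/
theorem norm_setIntegral_potential_mul_le {α : Potential}
    (hα : ∀ᵐ y ∂(volume.restrict (Set.Ici (0 : ℝ))), 0 ≤ α y) (g u : L2line (Set.Ici 0)) :
    ‖∫ y in Set.Ici 0, (α y : ℂ) * (g y * u y)‖
      ≤ √(∫ y in Set.Ici 0, α y * ‖g y‖ ^ 2) * √(∫ y in Set.Ici 0, α y * ‖u y‖ ^ 2) := by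
  have hm : ∀ v : L2line (Set.Ici 0), MemLp (fun y => (√(α y) : ℂ) * v y) 2
      (volume.restrict (Set.Ici 0)) ∧
      ∫ y in Set.Ici 0, ‖(√(α y) : ℂ) * v y‖ ^ 2 = ∫ y in Set.Ici 0, α y * ‖v y‖ ^ 2 := by
    intro v
    have hae : (fun y => ‖(√(α y) : ℂ) * v y‖ ^ 2)
        =ᵐ[volume.restrict (Set.Ici 0)] fun y => α y * ‖v y‖ ^ 2 := by
      filter_upwards [hα] with y hy
      rw [norm_mul, Complex.norm_real, mul_pow, Real.norm_eq_abs, sq_abs, Real.sq_sqrt hy]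
    refine ⟨?_, integral_congr_ae hae⟩
    have hsm : AEStronglyMeasurable (fun y => (√(α y) : ℂ) * v y) (volume.restrict (Set.Ici 0)) :=
      (Complex.continuous_ofReal.comp_aestronglyMeasurable
        (Real.continuous_sqrt.comp_aestronglyMeasurable (Lp.aestronglyMeasurable α))).mul
        (Lp.aestronglyMeasurable v)
    rw [memLp_two_iff_integrable_sq_norm hsm]
    exact (integrable_potential_mul_norm_sq α le_rfl v).congr hae.symm
  have h := norm_integral_mul_le (hm g).1 (hm u).1
  rw [(hm g).2, (hm u).2] at h
  refine le_trans (le_of_eq ?_) h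
  congr 1
  refine integral_congr_ae ?_
  filter_upwards [hα] with y hy
  have : ((√(α y) : ℂ)) * √(α y) = α y := by rw [← Complex.ofReal_mul, Real.mul_self_sqrt hy]
  rw [← this]
  ring

theorem eventually_le_of_tendsto_zero {α : Potential}
    (h : Tendsto (fun y => α y) (atTop ⊓ ae (volume.restrict (Set.Ici 0))) (𝓝 0)) {η : ℝ}
    (hη : 0 < η) : ∃ N : ℝ, ∀ᵐ y ∂(volume.restrict (Set.Ici (0 : ℝ))), N ≤ y → α y ≤ η := by
  have h1 : ∀ᶠ y in atTop ⊓ ae (volume.restrict (Set.Ici (0 : ℝ))), α y < η :=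
    h.eventually (eventually_lt_nhds hη)
  obtain ⟨s, hs, t, ht, hst⟩ := mem_inf_iff_superset.mp h1
  obtain ⟨N, hN⟩ := mem_atTop_sets.mp hs
  refine ⟨N, ?_⟩
  filter_upwards [ht] with y hy hNy
  exact (hst ⟨hN y hNy, hy⟩ : α y < η).le

end

/-! ### Quasi-modes in the form domain -/

section

variable {a d : ℝ} {f : ℝ → ℂ} {χ : ℝ → ℝ}

theorem deriv_star_comp (f : ℝ → ℂ) :
    deriv (fun c => star (f c)) = fun c => star (deriv f c) :=
  funext fun _ => deriv.star

/-- The form is antilinear in its first argument; conjugated modes make the identities bilinear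
in `f`. -/
theorem star_mode (f : ℝ → ℂ) (χ : ℝ → ℝ) (p : ℝ × ℝ) :
    star (mode (fun c => star (f c)) χ p) = mode f χ p := by
  simp [mode]

theorem star_fderiv_mode (hf : ContDiff ℝ ∞ f) (hχ : ContDiff ℝ ∞ χ) (p e : ℝ × ℝ) :
    star (fderiv ℝ (mode (fun c => star (f c)) χ) p e) = fderiv ℝ (mode f χ) p e := by
  have hf' : ContDiff ℝ ∞ fun c => star (f c) := Complex.conjCLE.contDiff.comp hf
  rw [fderiv_mode (hf'.differentiable (by simp)) (hχ.differentiable (by simp)),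
    fderiv_mode (hf.differentiable (by simp)) (hχ.differentiable (by simp)), deriv_star_comp]
  simp

theorem tsupport_star (f : ℝ → ℂ) : tsupport (fun c => star (f c)) = tsupport f := by
  unfold tsupport
  congr 1
  ext c
  simp

/-- The mode with profiles `f̄` and `χ`, where `f` is supported in the strip, as an element
of the form domain. -/
theorem exists_mode_formData (hd : 0 < d) (had : a * d = Real.pi / 2) (hχ : IsProfile a d χ)
    (hf : ContDiff ℝ ∞ f) {T : ℝ} (hft : tsupport f ⊆ Set.Ioo d T) :
    ∃ G : FormData d, InFormDomain d G ∧
      G.1.1 =ᵐ[volume.restrict (pencil d)] (fun p => star (mode f χ p)) ∧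
      G.1.2.1 =ᵐ[volume.restrict (pencil d)] (fun p => star (fderiv ℝ (mode f χ) p (1, 0))) ∧
      G.1.2.2 =ᵐ[volume.restrict (pencil d)] (fun p => star (fderiv ℝ (mode f χ) p (0, 1))) ∧
      G.2.1 = 0 ∧ G.2.2.1 = 0 ∧
      G.2.2.2 =ᵐ[volume.restrict (Set.Ici 0)] (fun y => star (f y)) := by
  have hfc : HasCompactSupport f :=
    isCompact_Icc.of_isClosed_subset (isClosed_tsupport f) (hft.trans Set.Ioo_subset_Icc_self)
  have gs : ContDiff ℝ ∞ fun c => star (f c) := Complex.conjCLE.contDiff.comp hf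
  have gc : HasCompactSupport fun c => star (f c) := by
    rw [HasCompactSupport, tsupport_star]
    exact hfc
  have h1 := contDiff_mode gs hχ.contDiff
  have h2 := hasCompactSupport_mode gc hχ.hasCompactSupport
  have hm : MemLp (fun c => star (f c)) 2 (volume.restrict (Set.Ici 0)) :=
    (gs.continuous.memLp_of_hasCompactSupport gc).restrict _
  have hz : ∀ c ≤ d, f c = 0 := fun c hc =>
    image_eq_zero_of_notMem_tsupport fun h => absurd (hft h).1 (not_lt.mpr hc)
  have hχd : χ d = 0 := by
    rw [hχ.eq_cos d (abs_of_pos hd).le, had, Real.cos_pi_div_two]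
  have hχd' : χ (-d) = 0 := by
    rw [hχ.eq_cos (-d) (by rw [abs_neg, abs_of_pos hd]), mul_neg, Real.cos_neg, had,
      Real.cos_pi_div_two]
  have hχ0 : χ 0 = 1 := by
    rw [hχ.eq_cos 0 (by simpa using hd.le), mul_zero, Real.cos_zero]
  refine ⟨(smoothJet (pencil d) h1 h2, 0, 0, hm.toLp _), ⟨isH1_smoothJet _ h1 h2,
    hasTrace_smoothJet _ h1 h2 _ _ _ ?_, hasTrace_smoothJet _ h1 h2 _ _ _ ?_,
    hasTrace_smoothJet _ h1 h2 _ _ _ ?_, hasTrace_smoothJet _ h1 h2 _ _ _ ?_,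
    hasTrace_smoothJet _ h1 h2 _ _ _ ?_⟩, ?_, ?_, ?_, rfl, rfl, hm.coeFn_toLp⟩
  · filter_upwards [Lp.coeFn_zero ℂ 2 (volume.restrict (Set.Ici (0 : ℝ)))] with t ht
    rw [ht]
    simp [mode, hχd]
  · filter_upwards [Lp.coeFn_zero ℂ 2 (volume.restrict (Set.Ici (0 : ℝ)))] with t ht
    rw [ht]
    simp [mode, hχd']
  · filter_upwards [Lp.coeFn_zero ℂ 2 (volume.restrict (Set.Icc (0 : ℝ) d)),
      ae_restrict_mem measurableSet_Icc] with t ht htd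
    rw [ht]
    simp [mode, hz (t / 2) (by linarith [htd.1, htd.2])]
  · filter_upwards [Lp.coeFn_zero ℂ 2 (volume.restrict (Set.Icc (0 : ℝ) d)),
      ae_restrict_mem measurableSet_Icc] with t ht htd
    rw [ht]
    simp [mode, hz (t / 2) (by linarith [htd.1, htd.2])]
  · filter_upwards [hm.coeFn_toLp] with t ht
    rw [ht]
    simp [mode, hχ0]
  · filter_upwards [(memLp_of_contDiff h1 h2 (pencil d)).coeFn_toLp] with p hp
    rw [← star_mode f χ p, star_star]
    exact hp
  · filter_upwards [(memLp_fderiv_apply h1 h2 (pencil d) (1, 0)).coeFn_toLp] with p hp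
    rw [← star_fderiv_mode hf hχ.contDiff, star_star]
    exact hp
  · filter_upwards [(memLp_fderiv_apply h1 h2 (pencil d) (0, 1)).coeFn_toLp] with p hp
    rw [← star_fderiv_mode hf hχ.contDiff, star_star]
    exact hp

/-- Every energy above the threshold has approximate eigenfunctions: modes far out in the strip,
where the interaction is weak. -/
theorem exists_quasimode (hd : 0 < d) (σ : Potential) {α : Potential}
    (hα : ∀ᵐ y ∂(volume.restrict (Set.Ici (0 : ℝ))), 0 ≤ α y)
    (hα0 : Tendsto (fun y => α y) (atTop ⊓ ae (volume.restrict (Set.Ici 0))) (𝓝 0))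
    {E : ℝ} (hE : threshold d ≤ E) {δ : ℝ} (hδ : 0 < δ) :
    ∃ G : FormData d, InFormDomain d G ∧ 0 < ‖G.1.1‖ ∧ ∀ F : FormData d, InFormDomain d F →
      ‖form d σ α G F - E * inner ℂ G.1.1 F.1.1‖
        ≤ δ * ‖G.1.1‖ * (‖F.1.1‖ + √(∫ y in Set.Ici 0, α y * ‖F.2.2.2 y‖ ^ 2)) := by
  have hpi := Real.pi_pos
  obtain ⟨a, ha⟩ : ∃ a, a = Real.pi / (2 * d) := ⟨_, rfl⟩
  have ha0 : a ≠ 0 := by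
    rw [ha]
    positivity
  have had : a * d = Real.pi / 2 := by
    rw [ha]
    field_simp
  obtain ⟨k, hk⟩ : ∃ k : ℝ, k ^ 2 = 2 * (E - 2 * a ^ 2) :=
    ⟨√(2 * (E - 2 * a ^ 2)), Real.sq_sqrt (by rw [ha]; unfold threshold at hE; linarith)⟩
  -- `‖φ‖² = d ∫ |f|²` and `|-Δφ - E φ| = ½ |f'' + k² f| |χ|`, whence the constants `d δ²` for the
  -- smallness of `α` on the support of `f` and `4 δ²` for the error of `f`
  obtain ⟨N, hN⟩ := eventually_le_of_tendsto_zero hα0 (η := d * δ ^ 2) (by positivity)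
  obtain ⟨f, T, hf, hft', hM, herr⟩ :=
    exists_quasimode_line k (max N d) (δ := 4 * δ ^ 2) (by positivity)
  obtain ⟨χ, hχ1, hχ2, hχ3⟩ := exists_transverse_profile a hd
  have hχ : IsProfile a d χ := ⟨hχ1, hχ2, fun t ht => (hχ3 t ht).1, fun t ht => (hχ3 t ht).2⟩
  have hft : tsupport f ⊆ Set.Ioo d T := hft'.trans (Set.Ioo_subset_Ioo_left (le_max_right _ _))
  have hft2 : tsupport f ⊆ Set.Ioo (d / 2) T :=
    hft.trans (Set.Ioo_subset_Ioo_left (by linarith))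
  have hfc : HasCompactSupport f :=
    isCompact_Icc.of_isClosed_subset (isClosed_tsupport f) (hft.trans Set.Ioo_subset_Icc_self)
  have hz : ∀ c ≤ d / 2, c ∉ tsupport f := fun c hc h => absurd (hft2 h).1 (not_lt.mpr hc)
  obtain ⟨G, hG, g0, g1, g2, g3, g4, g5⟩ := exists_mode_formData hd had hχ hf hft
  -- the longitudinal profile of the error `-Δφ - E φ`
  obtain ⟨r, hr⟩ : ∃ r : ℝ → ℂ, ∀ c, r c = laplaceProfile a f c - E * f c := ⟨_, fun _ => rfl⟩
  have hrs : ContDiff ℝ ∞ r := by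
    rw [funext hr]
    exact (contDiff_laplaceProfile a hf).sub (contDiff_const.mul hf)
  have hr0 : ∀ c, c ∉ tsupport f → r c = 0 := fun c hc => by
    rw [hr, laplaceProfile_eq_zero a hc, image_eq_zero_of_notMem_tsupport hc, mul_zero, sub_zero]
  have hrc : HasCompactSupport r := HasCompactSupport.intro hfc.isCompact hr0
  have hkC : (k : ℂ) ^ 2 = 2 * (E - 2 * a ^ 2) := by exact_mod_cast congrArg (fun x : ℝ => (x : ℂ)) hk
  have hrn : ∀ c, ‖r c‖ ^ 2 = 1 / 4 * ‖deriv (deriv f) c + k ^ 2 * f c‖ ^ 2 := by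
    intro c
    have : r c = (-1 / 2 : ℂ) * (deriv (deriv f) c + k ^ 2 * f c) := by
      rw [hr, laplaceProfile, hkC]
      ring
    rw [this, norm_mul, mul_pow]
    norm_num
  have hGnorm : ‖G.1.1‖ ^ 2 = d * ∫ c, ‖f c‖ ^ 2 := by
    rw [← setIntegral_pencil_norm_sq_mode hd ha0 had hχ hf hfc
      fun c hc => image_eq_zero_of_notMem_tsupport (hz c hc)]
    have := integral_norm_sq_eq_norm_toLp (Lp.memLp G.1.1)
    rw [Lp.toLp_coeFn] at this
    rw [← this]
    refine integral_congr_ae ?_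
    filter_upwards [g0] with p hp
    rw [hp, norm_star]
  have hrnorm : √(∫ p in pencil d, ‖mode r χ p‖ ^ 2) ≤ δ * ‖G.1.1‖ := by
    rw [setIntegral_pencil_norm_sq_mode hd ha0 had hχ hrs hrc fun c hc => hr0 c (hz c hc)]
    simp only [hrn]
    rw [integral_const_mul]
    refine Real.sqrt_le_iff.mpr ⟨by positivity, ?_⟩
    rw [mul_pow, hGnorm]
    nlinarith [mul_le_mul_of_nonneg_left herr hd.le]
  have hdiag : √(∫ y in Set.Ici 0, α y * ‖G.2.2.2 y‖ ^ 2) ≤ δ * ‖G.1.1‖ := by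
    refine Real.sqrt_le_iff.mpr ⟨by positivity, ?_⟩
    have hfi : Integrable fun c => ‖f c‖ ^ 2 := by
      have := hf.continuous
      exact Continuous.integrable_of_hasCompactSupport (by fun_prop) (hasCompactSupport_norm_sq hfc)
    calc ∫ y in Set.Ici 0, α y * ‖G.2.2.2 y‖ ^ 2
        ≤ ∫ y in Set.Ici 0, d * δ ^ 2 * ‖f y‖ ^ 2 := by
          refine integral_mono_ae (integrable_potential_mul_norm_sq α le_rfl _)
            (hfi.integrableOn.const_mul _) ?_
          filter_upwards [hN, g5] with y hy hg
          rw [hg, norm_star]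
          by_cases hyf : y ∈ tsupport f
          · exact mul_le_mul_of_nonneg_right
              (hy ((le_max_left _ _).trans (hft' hyf).1.le)) (sq_nonneg _)
          · simp [image_eq_zero_of_notMem_tsupport hyf]
      _ ≤ ∫ y, d * δ ^ 2 * ‖f y‖ ^ 2 :=
          setIntegral_le_integral (hfi.const_mul _) (Eventually.of_forall fun y => by positivity)
      _ = (δ * ‖G.1.1‖) ^ 2 := by
          rw [integral_const_mul, mul_pow, hGnorm]
          ring
  have hGpos : 0 < ‖G.1.1‖ := by
    have := mul_pos hd hM
    rw [← hGnorm] at this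
    exact (norm_nonneg _).lt_of_ne' fun h => by simp [h] at this
  refine ⟨G, hG, hGpos, fun F hF => ?_⟩
  have φ1 := contDiff_mode hf hχ.contDiff
  have φ2 := hasCompactSupport_mode hfc hχ.hasCompactSupport
  have m1 := memLp_fderiv_apply φ1 φ2 (pencil d) (1, 0)
  have m2 := memLp_fderiv_apply φ1 φ2 (pencil d) (0, 1)
  have m3 := memLp_of_contDiff (contDiff_mode (contDiff_laplaceProfile a hf) hχ.contDiff)
    (hasCompactSupport_mode (hasCompactSupport_laplaceProfile a hfc) hχ.hasCompactSupport)
    (pencil d)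
  have hrm := memLp_of_contDiff (contDiff_mode hrs hχ.contDiff)
    (hasCompactSupport_mode hrc hχ.hasCompactSupport) (pencil d)
  have hgrad : ∫ p in pencil d,
      (inner ℂ (G.1.2.1 p) (F.1.2.1 p) + inner ℂ (G.1.2.2 p) (F.1.2.2 p))
      = ∫ p in pencil d, mode (laplaceProfile a f) χ p * F.1.1 p := by
    have h1 := setIntegral_pencil_green hd had hχ hf hft2 hF
    rw [integral_mul_add_mul_sub_mul m1 m2 m3 (Lp.memLp _) (Lp.memLp _) (Lp.memLp _),
      sub_eq_zero] at h1
    rw [← h1, ← integral_add (integrable_mul_of_memLp_two m1 (Lp.memLp _))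
      (integrable_mul_of_memLp_two m2 (Lp.memLp _))]
    refine integral_congr_ae ?_
    filter_upwards [g1, g2] with p h1 h2
    simp [h1, h2, mul_comm]
  have hinner : inner ℂ G.1.1 F.1.1 = ∫ p in pencil d, mode f χ p * F.1.1 p := by
    rw [L2.inner_def]
    refine integral_congr_ae ?_
    filter_upwards [g0] with p h1
    simp [h1, mul_comm]
  have hside : ∫ y in Set.Icc 0 d,
      (σ y : ℂ) * (inner ℂ (G.2.1 y) (F.2.1 y) + inner ℂ (G.2.2.1 y) (F.2.2.1 y)) = 0 := by
    rw [g3, g4]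
    refine integral_eq_zero_of_ae ?_
    filter_upwards [Lp.coeFn_zero ℂ 2 (volume.restrict (Set.Icc (0 : ℝ) d))] with y hy
    simp only [hy, Pi.zero_apply, inner_zero_left, add_zero, mul_zero]
  have hsplit : form d σ α G F - E * inner ℂ G.1.1 F.1.1
      = (∫ p in pencil d, mode r χ p * F.1.1 p)
        + ∫ y in Set.Ici 0, (α y : ℂ) * inner ℂ (G.2.2.2 y) (F.2.2.2 y) := by
    have h1 : ∫ p in pencil d, mode r χ p * F.1.1 p
        = (∫ p in pencil d, mode (laplaceProfile a f) χ p * F.1.1 p)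
          - E * ∫ p in pencil d, mode f χ p * F.1.1 p := by
      rw [← integral_const_mul, ← integral_sub (integrable_mul_of_memLp_two m3 (Lp.memLp _))
        ((integrable_mul_of_memLp_two (memLp_of_contDiff φ1 φ2 (pencil d))
          (Lp.memLp _)).const_mul _)]
      refine integral_congr_ae (Eventually.of_forall fun p => ?_)
      simp only [mode, hr]
      ring
    rw [h1, hinner]
    unfold form
    rw [hgrad, hside]
    ring
  have hb1 := norm_integral_mul_le hrm (Lp.memLp F.1.1)
  rw [integral_norm_sq_eq_norm_toLp (Lp.memLp F.1.1), Lp.toLp_coeFn,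
    Real.sqrt_sq (norm_nonneg _)] at hb1
  have hb2 : ‖∫ y in Set.Ici 0, (α y : ℂ) * inner ℂ (G.2.2.2 y) (F.2.2.2 y)‖
      ≤ √(∫ y in Set.Ici 0, α y * ‖G.2.2.2 y‖ ^ 2)
        * √(∫ y in Set.Ici 0, α y * ‖F.2.2.2 y‖ ^ 2) := by
    have h := norm_setIntegral_potential_mul_le hα (star G.2.2.2) F.2.2.2
    have hst := Lp.coeFn_star G.2.2.2
    have e1 : ∫ y in Set.Ici 0, α y * ‖(star G.2.2.2 : L2line (Set.Ici 0)) y‖ ^ 2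
        = ∫ y in Set.Ici 0, α y * ‖G.2.2.2 y‖ ^ 2 := by
      refine integral_congr_ae ?_
      filter_upwards [hst] with y hy
      rw [hy, Pi.star_apply, norm_star]
    rw [e1] at h
    refine le_trans (le_of_eq ?_) h
    congr 1
    refine integral_congr_ae ?_
    filter_upwards [hst] with y hy
    rw [hy]
    simp [mul_comm]
  rw [hsplit, mul_add]
  exact (norm_add_le _ _).trans (add_le_add
    (hb1.trans (mul_le_mul_of_nonneg_right hrnorm (norm_nonneg _)))
    (hb2.trans (mul_le_mul_of_nonneg_right hdiag (Real.sqrt_nonneg _))))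

end

/-! ### The spectrum -/

/-- The defining property of the operator of the form. -/
theorem exists_formData_of_mem_domain {d : ℝ} {σ α : Potential}
    (φ : (hamiltonian d σ α).domain) : ∃ F : FormData d, InFormDomain d F ∧ F.1.1 = φ ∧
      ∀ G : FormData d, InFormDomain d G →
        form d σ α G F = inner ℂ G.1.1 (hamiltonian d σ α φ) := by
  have h : ((φ : L2 (pencil d)), hamiltonian d σ α φ)
      ∈ (operatorGraph d σ α).toLinearPMap.graph := (hamiltonian d σ α).mem_graph φ
  rw [Submodule.toLinearPMap_graph_eq _ (operatorGraph_single_valued d σ α)] at h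
  exact h

/-- Every energy above the threshold is in the spectrum: a bounded inverse `R` of `A - E` would
bound a quasi-mode `φ` by the small number `q(φ, Rφ) - E ⟨φ, Rφ⟩`. -/
theorem ofReal_mem_spectrum {d : ℝ} (hd : 0 < d) {σ α : Potential}
    (hσ : ∀ᵐ y ∂(volume.restrict (Set.Icc 0 d)), σ y ≤ -couplingBound d)
    (hα : ∀ᵐ y ∂(volume.restrict (Set.Ici (0 : ℝ))), 0 ≤ α y)
    (hα0 : Tendsto (fun y => α y) (atTop ⊓ ae (volume.restrict (Set.Ici 0))) (𝓝 0))
    {E : ℝ} (hE : threshold d ≤ E) :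
    (E : ℂ) ∈ UnboundedOperator.spectrum (hamiltonian d σ α) := by
  rintro ⟨R, hR, -⟩
  obtain ⟨C, hC0, hC⟩ : ∃ C, 0 ≤ C ∧ ∀ f, ‖R f‖ ≤ C * ‖f‖ :=
    ⟨‖R‖, norm_nonneg _, R.le_opNorm⟩
  have hE0 : 0 ≤ threshold d := by
    unfold threshold
    positivity
  have hE1 : 0 ≤ E := hE0.trans hE
  obtain ⟨K, hK0, hK⟩ : ∃ K : ℝ, 0 ≤ K ∧ K ^ 2 = C + E * C ^ 2 :=
    ⟨√(C + E * C ^ 2), Real.sqrt_nonneg _, Real.sq_sqrt (by positivity)⟩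
  -- below, `‖R φ‖ ≤ C ‖φ‖` and the diagonal term of `R φ` is at most `K ‖φ‖`
  obtain ⟨G, hG, hGpos, hq⟩ := exists_quasimode hd σ hα hα0 hE
    (δ := 1 / (C + K + 1)) (by positivity)
  obtain ⟨hdom, hres⟩ := hR G.1.1
  obtain ⟨F, hF, hFψ, hform⟩ := exists_formData_of_mem_domain ⟨R G.1.1, hdom⟩
  simp only at hFψ
  rw [sub_eq_iff_eq_add] at hres
  rw [hres] at hform
  have hψ : ‖F.1.1‖ ≤ C * ‖G.1.1‖ := hFψ ▸ hC G.1.1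
  have h1 : form d σ α G F - E * inner ℂ G.1.1 F.1.1 = (‖G.1.1‖ : ℂ) ^ 2 := by
    rw [hform G hG, inner_add_right, inner_smul_right, hFψ, inner_self_eq_norm_sq_to_K]
    simp
  have h2 := hq F hF
  rw [h1, norm_pow, Complex.norm_real, norm_norm] at h2
  have h3 : ∫ y in Set.Ici 0, α y * ‖F.2.2.2 y‖ ^ 2 ≤ (K * ‖G.1.1‖) ^ 2 := by
    have a1 := threshold_mul_add_le_form_self hd (α := α) hσ hF
    have a2 : (form d σ α F F).re ≤ ‖F.1.1‖ * ‖G.1.1‖ + E * ‖F.1.1‖ ^ 2 := by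
      rw [hform F hF, inner_add_right, inner_smul_right, hFψ, inner_self_eq_norm_sq_to_K]
      have b1 := (Complex.re_le_norm _).trans (norm_inner_le_norm (𝕜 := ℂ) (R G.1.1) G.1.1)
      have b2 : ((E : ℂ) * (‖R G.1.1‖ : ℂ) ^ 2).re = E * ‖R G.1.1‖ ^ 2 := by
        rw [← Complex.ofReal_pow, ← Complex.ofReal_mul, Complex.ofReal_re]
      simp only [Complex.add_re, Complex.coe_algebraMap] at b2 ⊢
      linarith
    have a3 : 0 ≤ threshold d * ‖F.1.1‖ ^ 2 := by positivity
    have a4 : ‖F.1.1‖ * ‖G.1.1‖ ≤ C * ‖G.1.1‖ * ‖G.1.1‖ :=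
      mul_le_mul_of_nonneg_right hψ (norm_nonneg _)
    have a5 : E * ‖F.1.1‖ ^ 2 ≤ E * (C * ‖G.1.1‖) ^ 2 :=
      mul_le_mul_of_nonneg_left (pow_le_pow_left₀ (norm_nonneg _) hψ 2) hE1
    rw [mul_pow, hK]
    linarith
  have h4 : √(∫ y in Set.Ici 0, α y * ‖F.2.2.2 y‖ ^ 2) ≤ K * ‖G.1.1‖ :=
    Real.sqrt_le_iff.mpr ⟨by positivity, h3⟩
  have h5 : ‖G.1.1‖ ^ 2 ≤ 1 / (C + K + 1) * ‖G.1.1‖ * ((C + K) * ‖G.1.1‖) := by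
    refine h2.trans (mul_le_mul_of_nonneg_left ?_ (by positivity))
    linarith
  have h6 : 1 / (C + K + 1) * ‖G.1.1‖ * ((C + K) * ‖G.1.1‖)
      = (C + K) / (C + K + 1) * ‖G.1.1‖ ^ 2 := by ring
  have h7 : (C + K) / (C + K + 1) < 1 := by
    rw [div_lt_one (by positivity)]
    linarith
  rw [h6] at h5
  exact absurd h5 (not_le.mpr (mul_lt_of_lt_one_left (by positivity) h7))

/-- With strong boundary repulsion, the eigenvalues are real and not below the threshold. -/
theorem eigenvalue_eq_ofReal {d : ℝ} (hd : 0 < d) {σ α : Potential}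
    (hσ : ∀ᵐ y ∂(volume.restrict (Set.Icc 0 d)), σ y ≤ -couplingBound d)
    (hα : ∀ᵐ y ∂(volume.restrict (Set.Ici (0 : ℝ))), 0 ≤ α y) {z : ℂ}
    (hz : UnboundedOperator.eigenspace (hamiltonian d σ α) z ≠ ⊥) :
    z = z.re ∧ threshold d ≤ z.re := by
  obtain ⟨φ, hφ, hφ0⟩ := Submodule.exists_mem_ne_zero_of_ne_bot hz
  have heq : hamiltonian d σ α φ = z • (φ : L2 (pencil d)) := sub_eq_zero.mp hφ
  obtain ⟨F, hF, hFφ, hform⟩ := exists_formData_of_mem_domain φ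
  have hpos : 0 < ‖F.1.1‖ ^ 2 := by
    have : F.1.1 ≠ 0 := by
      rw [hFφ]
      exact fun h => hφ0 (Subtype.ext h)
    positivity
  have h1 : form d σ α F F = z * ((‖F.1.1‖ ^ 2 : ℝ) : ℂ) := by
    rw [hform F hF, heq, inner_smul_right, hFφ, inner_self_eq_norm_sq_to_K]
    simp
  have h2 : (form d σ α F F).im = 0 := by rw [form_self, Complex.ofReal_im]
  have h3 := threshold_mul_add_le_form_self hd (α := α) hσ hF
  have h4 : 0 ≤ ∫ y in Set.Ici 0, α y * ‖F.2.2.2 y‖ ^ 2 := by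
    refine integral_nonneg_of_ae ?_
    filter_upwards [hα] with y hy
    exact mul_nonneg hy (sq_nonneg _)
  rw [h1, Complex.im_mul_ofReal] at h2
  rw [h1, Complex.re_mul_ofReal] at h3
  refine ⟨Complex.ext (Complex.ofReal_re _).symm ?_, ?_⟩
  · rw [Complex.ofReal_im]
    exact (mul_eq_zero.mp h2).resolve_right hpos.ne'
  · exact le_of_mul_le_mul_right (by linarith) hpos

end PencilModel

end

theorem mainTheorem8 (d : ℝ) (hd : 0 < d) :
    ∃ γ : ℝ, γ < 0 ∧ ∀ σ α : PencilModel.Potential,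
      (∀ᵐ y ∂(volume.restrict (Set.Icc 0 d)), σ y ≤ γ) →
      (∀ᵐ y ∂(volume.restrict (Set.Ici 0)), 0 ≤ α y) →
      Tendsto (fun y => α y) (atTop ⊓ ae (volume.restrict (Set.Ici 0))) (𝓝 0) →
      UnboundedOperator.discreteSpectrum (PencilModel.hamiltonian d σ α) = ∅ := by
  refine ⟨-PencilModel.couplingBound d, neg_lt_zero.mpr (PencilModel.couplingBound_pos hd),
    fun σ α hσ hα hα0 => ?_⟩
  rw [Set.eq_empty_iff_forall_notMem]
  rintro z ⟨hz, -, ε, hε, hiso⟩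
  obtain ⟨hre, hthr⟩ := PencilModel.eigenvalue_eq_ofReal hd hσ hα hz
  have hmem := PencilModel.ofReal_mem_spectrum hd hσ hα hα0 (E := z.re + ε / 2) (by linarith)
  have hsub : ((z.re + ε / 2 : ℝ) : ℂ) - z = ((ε / 2 : ℝ) : ℂ) := by
    nth_rewrite 2 [hre]
    push_cast
    ring
  have hdist : dist ((z.re + ε / 2 : ℝ) : ℂ) z = ε / 2 := by
    rw [dist_eq_norm, hsub, Complex.norm_real, Real.norm_of_nonneg (by positivity)]
  -- a point of the spectrum within `ε` of `z`, yet different from it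
  have h0 := hiso _ hmem (by rw [hdist]; linarith)
  rw [h0, dist_self] at hdist
  linarith
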